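/- For a function $\psi$ from the positive integers to $[0,1/2]$ and positive integers $q, r$, put $$\mathcal{A}_q=\bigcup_{\substack{1\le p\le q\\ \gcd(p,q)=1}}\left(\frac{p-\psi(q)}{q},\frac{p+\psi(q)}{q}\right)\subset\mathbb{R},\qquad D=D(q,r)=\frac{\max(r\psi(q),\,q\psi(r))}{\gcd(q,r)},$$ and let $\lambda$ denote Lebesgue measure on $\mathbb{R}$. In the products below, $p$ denotes a prime. (i) There is an absolute constant $K>0$ such that for every such $\psi$, all positive integers $q\ne r$ and all reals $u\ge 1$, $T\ge 2$, $$\lambda(\mathcal{A}_q\cap\mathcal{A}_r)\le\lambda(\mathcal{A}_q)\,\lambda(\mathcal{A}_r)\left(1+K\left(u^{-u/2}+\frac{T^u\log(D+2)\log T}{D}\right)\right)\prod_{\substack{p\,\mid\, qr/\gcd(q,r)^2\\ p>T}}\left(1+\frac1{p-1}\right).$$ (If $D=0$, then $\psi(q)=\psi(r)=0$, both sides vanish, and the fraction with denominator $D$ is read as $0$.) (ii) For every real $C\ge 1$ there is a constant $K_C>0$, depending only on $C$, such that for every such $\psi$ and all positive integers $q\ne r$, $$\lambda(\mathcal{A}_q\cap\mathcal{A}_r)\le\lambda(\mathcal{A}_q)\,\lambda(\mathcal{A}_r)\left(1+K_C\,(\log(D+2))^{-C}\right)\prod_{\substack{p\,\mid\,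 qr/\gcd(q,r)^2\\ p>A_C(q,r)}}\left(1+\frac1{p-1}\right),$$ where $$A_C(q,r)=\exp\left(\frac{\log(D+100)\,\log\log\log(D+100)}{8C\,\log\log(D+100)}+1\right).$$ -/

import Mathlib

open scoped BigOperators

noncomputable section

namespace DuffinSchaeffer

/-- The approximation set `𝒜_q`: the union, over `1 ≤ p ≤ q` with `gcd(p, q) = 1`, of the open
intervals of radius `ψ(q) / q` about `p / q` (a subset of the real line). -/
def approxSet (ψ : ℕ → ℝ) (q : ℕ) : Set ℝ :=
  ⋃ p ∈ (Finset.Icc 1 q).filter (fun p => Nat.Coprime p q),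
    Set.Ioo ((p : ℝ) / q - ψ q / q) ((p : ℝ) / q + ψ q / q)

/-- `D(q, r) = max (r ψ(q), q ψ(r)) / gcd(q, r)`. -/
def overlapD (ψ : ℕ → ℝ) (q r : ℕ) : ℝ :=
  max ((r : ℝ) * ψ q) ((q : ℝ) * ψ r) / (Nat.gcd q r : ℝ)

/-- The product of `1 + 1 / (p - 1)` over the primes `p > t` that divide the integer
`q r / gcd(q, r)²` (the division is exact). -/
def largePrimeProd (q r : ℕ) (t : ℝ) : ℝ :=
  ∏ p ∈ (q * r / Nat.gcd q r ^ 2).primeFactors with t < ((p : ℕ) : ℝ), (1 + 1 / ((p : ℝ) - 1))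

/-- The threshold `A_C(q, r) = exp (log X * logloglog X / (8 C loglog X) + 1)`
with `X = D(q, r) + 100`. -/
def thresholdA (ψ : ℕ → ℝ) (C : ℝ) (q r : ℕ) : ℝ :=
  Real.exp
    (Real.log (overlapD ψ q r + 100) * Real.log (Real.log (Real.log (overlapD ψ q r + 100))) /
      (8 * C * Real.log (Real.log (overlapD ψ q r + 100))) + 1)

end DuffinSchaeffer

end

namespace DuffinSchaeffer

open Finset

/-! Write q = gk and r = gl with g = gcd(q, r), and let δ = ψ(q)/q be the smaller radius and ε =
ψ(r)/r the larger, so that D = gklε. Fibre the overlap over the displacement y ∈ (-δ, δ) of a point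
from its centre a/q: the measure is at most 2δ times the largest number, over y, of pairs of reduced
fractions a/q, b/r with |a/q + y - b/r| < ε. Putting m = al - bk, this confines m to an interval of
length 2D whose centre -gkly has modulus at most D. Moreover m is prime to kl, and q ≠ r excludes m
= 0; for D < 1/2 no m is left.

For fixed m the pairs form a progression (a + kt, b + lt) with t modulo g. A prime p ∣ g excludes at
least one class of t, and two classes if p ∤ klm, so by the Chinese remainder theorem there are at
most φ(g) ∏ (p-2)/(p-1) pairs, over p ∣ g with p ∤ klm (`card_pairs_diff_eq_le`). This product is a
nonnegative combination of the indicators of d ∣ m, with d squarefree and composed of primes of g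
not dividing kl. It remains to count the m in the interval that are divisible by d and prime to kl.
Sieving only by primes p ≤ T, the fundamental lemma (`exists_card_coprime_le`) bounds this by (2D/d)
∏ (1 - 1/p) (1 + O(u^(-u/2))) + T^u.

Summed over d, the main terms reproduce λ(𝒜_q) λ(𝒜_r) exactly, except for the unsieved primes p > T,
which produce `largePrimeProd`. The error T^u is incurred only for d up to about 2D, because 0 < |m|
< 2D. The total weight of those d is O(log(D + 2)) times the expected product
(`exists_sum_divisorCoeff_le`), and Mertens' bound trades the missing sieve product for log T.

The fundamental lemma comes from Selberg's sieve with weights supported on d ≤ T^(u/2). Rankin's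
trick and Chebyshev's bound show that its denominator falls short of the full Euler product by a
relative u^(-u/2) only. Part (ii) is part (i) with T the threshold and u a suitable multiple of
loglog / logloglog of D + 100. -/

/-! ### Chebyshev and Mertens bounds over primes -/

/-- Abel summation: if the partial sums of `b` are nonnegative and `f` is antitone and nonnegative,
then so are the partial sums of `b * f`. -/
theorem mul_sum_Icc_le_sum_mul {b f : ℕ → ℝ} (hb : ∀ N, 0 ≤ ∑ n ∈ Icc 1 N, b n)
    (hf : ∀ n, 1 ≤ n → f (n + 1) ≤ f n) (N : ℕ) :
    f (N + 1) * ∑ n ∈ Icc 1 N, b n ≤ ∑ n ∈ Icc 1 N, b n * f n := by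
  induction N with
  | zero => simp
  | succ N ih =>
    rw [Finset.sum_Icc_succ_top (by omega), Finset.sum_Icc_succ_top (by omega)]
    have h1 := hf (N + 1) (by omega)
    have h2 := hb (N + 1)
    rw [Finset.sum_Icc_succ_top (by omega)] at h2
    nlinarith [mul_le_mul_of_nonneg_right h1 h2]

/-- Chebyshev's bound, summed by parts against an antitone function. -/
theorem sum_prime_log_mul_le {f : ℕ → ℝ} (hf0 : ∀ n, 0 ≤ f n)
    (hf : ∀ n, 1 ≤ n → f (n + 1) ≤ f n) {x : ℝ} {s : Finset ℕ}
    (hs : ∀ p ∈ s, p.Prime ∧ (p : ℝ) ≤ x) :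
    ∑ p ∈ s, Real.log p * f p ≤ Real.log 4 * ∑ n ∈ Icc 1 ⌊x⌋₊, f n := by
  have hcheb : ∀ N : ℕ, 0 ≤ ∑ n ∈ Icc 1 N,
      (Real.log 4 - if n.Prime then Real.log n else 0) := by
    intro N
    have h := Chebyshev.theta_le_log4_mul_x (x := N) (by positivity)
    rw [Chebyshev.theta_eq_sum_Icc, Nat.floor_natCast, Finset.sum_filter,
      ← Finset.sum_subset (s₁ := Icc 1 N)] at h
    · rw [Finset.sum_sub_distrib]
      simp only [sum_const, Nat.card_Icc, Nat.add_sub_cancel, nsmul_eq_mul]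
      linarith
    · exact Finset.Icc_subset_Icc_left (by omega)
    · intro n hn hn'
      have : n = 0 := by simp at hn hn'; omega
      subst this; simp
  have h := mul_sum_Icc_le_sum_mul hcheb hf ⌊x⌋₊
  have h0 := mul_nonneg (hf0 (⌊x⌋₊ + 1)) (hcheb ⌊x⌋₊)
  have h1 : ∑ p ∈ s, Real.log p * f p ≤
      ∑ n ∈ Icc 1 ⌊x⌋₊, (if n.Prime then Real.log n else 0) * f n := by
    have hsub : s ⊆ Icc 1 ⌊x⌋₊ := by
      intro p hp
      simp only [Finset.mem_Icc]
      exact ⟨(hs p hp).1.one_lt.le, Nat.le_floor (hs p hp).2⟩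
    refine le_trans (le_of_eq (Finset.sum_congr rfl fun p hp => ?_))
      (Finset.sum_le_sum_of_subset_of_nonneg hsub fun n _ _ => ?_)
    · rw [if_pos (hs p hp).1]
    · refine mul_nonneg ?_ (hf0 n)
      split_ifs
      · exact Real.log_natCast_nonneg n
      · exact le_rfl
  have h2 : ∑ n ∈ Icc 1 ⌊x⌋₊, (Real.log 4 - if n.Prime then Real.log n else 0) * f n =
      Real.log 4 * ∑ n ∈ Icc 1 ⌊x⌋₊, f n -
        ∑ n ∈ Icc 1 ⌊x⌋₊, (if n.Prime then Real.log n else 0) * f n := by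
    rw [Finset.mul_sum, ← Finset.sum_sub_distrib]
    exact Finset.sum_congr rfl fun n _ => by ring
  linarith

theorem sum_Icc_inv_le {x : ℝ} (hx : 1 ≤ x) :
    ∑ n ∈ Icc 1 ⌊x⌋₊, (n : ℝ)⁻¹ ≤ 1 + Real.log x := by
  have h := harmonic_floor_le_one_add_log x hx
  rw [harmonic_eq_sum_Icc] at h
  push_cast at h
  exact h

theorem sum_prime_log_div_le {x : ℝ} (hx : 1 ≤ x) {s : Finset ℕ}
    (hs : ∀ p ∈ s, p.Prime ∧ (p : ℝ) ≤ x) :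
    ∑ p ∈ s, Real.log p / p ≤ Real.log 4 * (1 + Real.log x) := by
  have h := sum_prime_log_mul_le (f := fun n => (n : ℝ)⁻¹) (fun n => by positivity)
    (fun n hn => by
      have : (0 : ℝ) < n := by exact_mod_cast hn
      gcongr
      simp) hs
  refine le_trans (le_of_eq (Finset.sum_congr rfl fun p _ => div_eq_mul_inv _ _)) (h.trans ?_)
  have := sum_Icc_inv_le hx
  have h4 : 0 ≤ Real.log 4 := Real.log_nonneg (by norm_num)
  gcongr

/-- Induction on N; the increment is Bernoulli's inequality (1 - 1/(N+1))^κ ≤ 1 - κ/(N+1), valid for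
0 ≤ κ ≤ 1. -/
theorem sum_Icc_rpow_sub_one_le {κ : ℝ} (hκ : 0 < κ) (hκ1 : κ ≤ 1) (N : ℕ) :
    ∑ n ∈ Icc 1 N, (n : ℝ) ^ (κ - 1) ≤ (N : ℝ) ^ κ / κ := by
  induction N with
  | zero => simp [Real.zero_rpow hκ.ne']
  | succ N ih =>
    rw [Finset.sum_Icc_succ_top (by omega)]
    have hN : (0 : ℝ) < ((N + 1 : ℕ) : ℝ) := by positivity
    have hs : -1 ≤ -(((N + 1 : ℕ) : ℝ))⁻¹ := by
      have : (((N + 1 : ℕ) : ℝ))⁻¹ ≤ 1 := inv_le_one_of_one_le₀ (by exact_mod_cast Nat.succ_pos N)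
      linarith
    have h := rpow_one_add_le_one_add_mul_self hs hκ.le hκ1
    have h1 : (1 + -(((N + 1 : ℕ) : ℝ))⁻¹) = (N : ℝ) / ((N + 1 : ℕ) : ℝ) := by
      field_simp; push_cast; ring
    rw [h1, Real.div_rpow (by positivity) hN.le, div_le_iff₀ (by positivity)] at h
    have h2 : ((N + 1 : ℕ) : ℝ) ^ (κ - 1) = ((N + 1 : ℕ) : ℝ) ^ κ * (((N + 1 : ℕ) : ℝ))⁻¹ := by
      rw [Real.rpow_sub hN, Real.rpow_one, div_eq_mul_inv]
    rw [h2]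
    rw [le_div_iff₀ hκ] at ih ⊢
    nlinarith

theorem sum_prime_log_mul_rpow_le {κ x : ℝ} (hκ : 0 < κ) (hκ1 : κ ≤ 1) (hx : 0 ≤ x)
    {s : Finset ℕ} (hs : ∀ p ∈ s, p.Prime ∧ (p : ℝ) ≤ x) :
    ∑ p ∈ s, Real.log p * (p : ℝ) ^ (κ - 1) ≤ Real.log 4 * (x ^ κ / κ) := by
  have h := sum_prime_log_mul_le (f := fun n => (n : ℝ) ^ (κ - 1)) (fun n => by positivity)
    (fun n hn => Real.rpow_le_rpow_of_nonpos (by exact_mod_cast hn) (by simp) (by linarith)) hs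
  refine h.trans ?_
  have h4 : 0 ≤ Real.log 4 := Real.log_nonneg (by norm_num)
  have h5 := sum_Icc_rpow_sub_one_le hκ hκ1 ⌊x⌋₊
  have h6 : (⌊x⌋₊ : ℝ) ^ κ ≤ x ^ κ :=
    Real.rpow_le_rpow (by positivity) (Nat.floor_le hx) hκ.le
  have h7 : (⌊x⌋₊ : ℝ) ^ κ / κ ≤ x ^ κ / κ := by gcongr
  exact mul_le_mul_of_nonneg_left (h5.trans h7) h4

/-- The exponential sum over primes that controls the tail in the Selberg sieve. -/
theorem sum_prime_rpow_sub_one_div_le {κ x : ℝ} (hκ : 0 < κ) (hκ1 : κ ≤ 1) (hx : 1 < x)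
    {s : Finset ℕ} (hs : ∀ p ∈ s, p.Prime ∧ (p : ℝ) ≤ x) :
    ∑ p ∈ s, ((p : ℝ) ^ κ - 1) / p ≤ Real.log 4 *
      (Real.exp (κ * Real.log x / 2) * (1 + κ * Real.log x) +
        2 * (Real.exp (κ * Real.log x) / (κ * Real.log x))) := by
  have h4 : 0 ≤ Real.log 4 := Real.log_nonneg (by norm_num)
  have hlx : 0 < Real.log x := Real.log_pos hx
  have hx0 : 0 < x := by linarith
  -- Split at √x. Below it, p^κ - 1 ≤ κ log p · p^κ with p^κ ≤ x^(κ/2). Above it, drop the -1 and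
  -- insert the factor 2 log p / log x ≥ 1, which makes Chebyshev's bound applicable.
  rw [← Finset.sum_filter_add_sum_filter_not s (fun p : ℕ => Real.log p ≤ Real.log x / 2), mul_add]
  refine add_le_add ?_ ?_
  · have h1 : ∀ p ∈ s.filter (fun p : ℕ => Real.log p ≤ Real.log x / 2),
        ((p : ℝ) ^ κ - 1) / p ≤ κ * Real.exp (κ * Real.log x / 2) * (Real.log p / p) := by
      intro p hp
      obtain ⟨hps, hpl⟩ := Finset.mem_filter.1 hp
      have hp0 : (0 : ℝ) < p := by exact_mod_cast (hs p hps).1.pos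
      rw [← mul_div_assoc]
      gcongr
      have e : (p : ℝ) ^ κ = Real.exp (κ * Real.log p) := by
        rw [Real.rpow_def_of_pos hp0, mul_comm]
      have e1 := Real.add_one_le_exp (-(κ * Real.log p))
      have e2 : Real.exp (κ * Real.log p) - 1 ≤ κ * Real.log p * Real.exp (κ * Real.log p) := by
        have : Real.exp (-(κ * Real.log p)) * Real.exp (κ * Real.log p) = 1 := by
          rw [← Real.exp_add]; simp
        nlinarith [Real.exp_pos (κ * Real.log p)]
      have e3 : Real.exp (κ * Real.log p) ≤ Real.exp (κ * Real.log x / 2) := by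
        apply Real.exp_le_exp.2; nlinarith
      have e4 : 0 ≤ Real.log p := Real.log_natCast_nonneg p
      rw [e]
      calc _ ≤ _ := e2
        _ ≤ κ * Real.log p * Real.exp (κ * Real.log x / 2) := by gcongr
        _ = _ := by ring
    refine (Finset.sum_le_sum h1).trans ?_
    rw [← Finset.mul_sum]
    have h2 := sum_prime_log_div_le hx.le (s := s.filter (fun p : ℕ => Real.log p ≤ Real.log x / 2))
      (fun p hp => hs p (Finset.mem_filter.1 hp).1)
    calc _ ≤ κ * Real.exp (κ * Real.log x / 2) * (Real.log 4 * (1 + Real.log x)) := by gcongr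
      _ = Real.log 4 * (Real.exp (κ * Real.log x / 2) * (κ + κ * Real.log x)) := by ring
      _ ≤ _ := by gcongr
  · have h1 : ∀ p ∈ s.filter (fun p : ℕ => ¬ Real.log p ≤ Real.log x / 2),
        ((p : ℝ) ^ κ - 1) / p ≤ 2 / Real.log x * (Real.log p * (p : ℝ) ^ (κ - 1)) := by
      intro p hp
      obtain ⟨hps, hpl⟩ := Finset.mem_filter.1 hp
      have hp0 : (0 : ℝ) < p := by exact_mod_cast (hs p hps).1.pos
      push Not at hpl
      have e : (p : ℝ) ^ (κ - 1) = (p : ℝ) ^ κ / p := by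
        rw [Real.rpow_sub hp0, Real.rpow_one]
      have e1 : 1 ≤ 2 / Real.log x * Real.log p := by
        rw [div_mul_eq_mul_div, le_div_iff₀ hlx]; linarith
      have e2 : 0 ≤ (p : ℝ) ^ κ / p := by positivity
      rw [e]
      calc ((p : ℝ) ^ κ - 1) / p ≤ (p : ℝ) ^ κ / p := by gcongr; linarith
        _ ≤ 2 / Real.log x * Real.log p * ((p : ℝ) ^ κ / p) := le_mul_of_one_le_left e2 e1
        _ = _ := by ring
    refine (Finset.sum_le_sum h1).trans ?_
    rw [← Finset.mul_sum]
    have h2 := sum_prime_log_mul_rpow_le hκ hκ1 hx0.le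
      (s := s.filter (fun p : ℕ => ¬ Real.log p ≤ Real.log x / 2))
      (fun p hp => hs p (Finset.mem_filter.1 hp).1)
    calc _ ≤ 2 / Real.log x * (Real.log 4 * (x ^ κ / κ)) := by gcongr
      _ = _ := by
        rw [Real.rpow_def_of_pos hx0, mul_comm (Real.log x) κ]
        field_simp

/-- Comparison with ∫ t^(-1-η) dt in telescoped form: n^(-1-η) ≤ ((n-1)^(-η) - n^(-η))/η for n ≥ 2.
The term n = 0 is 0. -/
theorem tsum_nat_rpow_neg_le {η : ℝ} (hη : 0 < η) :
    ∑' n : ℕ, (n : ℝ) ^ (-(1 + η)) ≤ 1 + 1 / η := by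
  have key : ∀ N : ℕ, ∑ n ∈ Finset.range (N + 2), (n : ℝ) ^ (-(1 + η)) ≤
      1 + 1 / η - ((N + 1 : ℕ) : ℝ) ^ (-η) / η := by
    intro N
    induction N with
    | zero =>
      simp [Finset.sum_range_succ,
        Real.zero_rpow (show -η + -1 ≠ 0 by linarith)]
    | succ N ih =>
      rw [Finset.sum_range_succ]
      have hN : (0 : ℝ) < ((N + 1 : ℕ) : ℝ) := by positivity
      have hM : (0 : ℝ) < ((N + 2 : ℕ) : ℝ) := by positivity
      set x : ℝ := ((N + 1 : ℕ) : ℝ) / ((N + 2 : ℕ) : ℝ) with hx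
      have hx0 : 0 < x := by positivity
      have h1 : Real.log x ≤ x - 1 := Real.log_le_sub_one_of_pos hx0
      have h2 : 1 + η * (((N + 2 : ℕ) : ℝ))⁻¹ ≤ x ^ (-η) := by
        rw [Real.rpow_def_of_pos hx0]
        have h3 := Real.add_one_le_exp (Real.log x * -η)
        have h4 : x - 1 = -(((N + 2 : ℕ) : ℝ))⁻¹ := by
          rw [hx]; field_simp; push_cast; ring
        rw [h4] at h1
        nlinarith
      rw [hx, Real.div_rpow hN.le hM.le, le_div_iff₀ (by positivity)] at h2
      have h5 : ((N + 2 : ℕ) : ℝ) ^ (-(1 + η)) =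
          ((N + 2 : ℕ) : ℝ) ^ (-η) * (((N + 2 : ℕ) : ℝ))⁻¹ := by
        rw [← Real.rpow_neg_one, ← Real.rpow_add hM]; ring_nf
      rw [h5]
      have h6 : ((N + 2 : ℕ) : ℝ) ^ (-η) * (((N + 2 : ℕ) : ℝ))⁻¹ ≤
          ((N + 1 : ℕ) : ℝ) ^ (-η) / η - ((N + 2 : ℕ) : ℝ) ^ (-η) / η := by
        rw [← sub_div, le_div_iff₀ hη]; linarith
      have h7 : (N + 1 + 1 : ℕ) = N + 2 := rfl
      rw [h7]
      linarith
  refine Real.tsum_le_of_sum_range_le (fun n => by positivity) fun n => ?_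
  refine le_trans ?_ ((key n).trans (sub_le_self _ (by positivity)))
  exact Finset.sum_le_sum_of_subset_of_nonneg (Finset.range_mono (by omega))
    fun n _ _ => by positivity

/-- The finite Euler product is the part of the series for ζ(1 + η) over integers with all prime
factors in s. -/
theorem prod_prime_one_sub_rpow_inv_le {η : ℝ} (hη : 0 < η) {s : Finset ℕ}
    (hs : ∀ p ∈ s, p.Prime) :
    ∏ p ∈ s, (1 - (p : ℝ) ^ (-(1 + η)))⁻¹ ≤ 1 + 1 / η := by
  let f : ℕ →* ℝ :=
    { toFun := fun n => (n : ℝ) ^ (-(1 + η))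
      map_one' := by simp
      map_mul' := fun a b => by
        push_cast
        exact Real.mul_rpow (by positivity) (by positivity) }
  have hf : ∀ {p : ℕ}, p.Prime → ‖f p‖ < 1 := by
    intro p hp
    change ‖(p : ℝ) ^ (-(1 + η))‖ < 1
    rw [Real.norm_of_nonneg (by positivity)]
    exact Real.rpow_lt_one_of_one_lt_of_neg (by exact_mod_cast hp.one_lt) (by linarith)
  have h := (EulerProduct.summable_and_hasSum_factoredNumbers_prod_filter_prime_geometric hf s).2
  rw [Finset.filter_true_of_mem hs] at h
  have hsum : Summable fun n : ℕ => (n : ℝ) ^ (-(1 + η)) :=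
    Real.summable_nat_rpow.2 (by linarith)
  have h1 : ∏ p ∈ s, (1 - (p : ℝ) ^ (-(1 + η)))⁻¹ =
      ∑' m : Nat.factoredNumbers s, ((m : ℕ) : ℝ) ^ (-(1 + η)) := h.tsum_eq.symm
  rw [h1]
  exact (Summable.tsum_subtype_le (fun n : ℕ => (n : ℝ) ^ (-(1 + η))) _
    (fun n => by positivity) hsum).trans (tsum_nat_rpow_neg_le hη)

theorem prime_inv_le_half {p : ℕ} (hp : p.Prime) : (p : ℝ)⁻¹ ≤ 1 / 2 := by
  rw [one_div]
  have : (2 : ℝ) ≤ p := by exact_mod_cast hp.two_le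
  gcongr

/-- The upper bound in Mertens' third theorem. -/
theorem exists_prod_prime_one_sub_inv_le :
    ∃ K : ℝ, 0 < K ∧ ∀ x : ℝ, 2 ≤ x → ∀ s : Finset ℕ, (∀ p ∈ s, p.Prime ∧ (p : ℝ) ≤ x) →
      ∏ p ∈ s, (1 - (p : ℝ)⁻¹)⁻¹ ≤ K * Real.log x := by
  have hl2 : 0 < Real.log 2 := Real.log_pos (by norm_num)
  have hl4 : 0 < Real.log 4 := Real.log_pos (by norm_num)
  refine ⟨Real.exp (2 * (Real.log 4 * (1 / Real.log 2 + 1))) * (1 / Real.log 2 + 1),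
    by positivity, fun x hx s hs => ?_⟩
  have hlx : Real.log 2 ≤ Real.log x := Real.log_le_log (by norm_num) hx
  have hlx0 : 0 < Real.log x := by linarith
  -- With η = 1/log x, moving the Euler factors from 1 to 1 + η costs exp(2η ∑ log p / p), which is
  -- bounded, while ζ(1 + η) ≤ 1 + log x.
  set η : ℝ := 1 / Real.log x with hηdef
  have hη : 0 < η := by positivity
  have hterm : ∀ p ∈ s, (1 - (p : ℝ)⁻¹)⁻¹ ≤
      Real.exp (2 * η * (Real.log p / p)) * (1 - (p : ℝ) ^ (-(1 + η)))⁻¹ := by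
    intro p hp
    have hpp := (hs p hp).1
    have hp0 : (0 : ℝ) < p := by exact_mod_cast hpp.pos
    have hpi := prime_inv_le_half hpp
    set a : ℝ := (p : ℝ)⁻¹ with ha
    have ha0 : 0 < a := by positivity
    have e1 : (p : ℝ) ^ (-(1 + η)) = a * Real.exp (-(η * Real.log p)) := by
      rw [show -(1 + η) = -1 + -η by ring, Real.rpow_add hp0, Real.rpow_neg_one,
        Real.rpow_def_of_pos hp0 (-η)]
      congr 2; ring
    have e2 := Real.add_one_le_exp (-(η * Real.log p))
    have e3 : 0 ≤ Real.log p := Real.log_natCast_nonneg p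
    have e3' : 0 ≤ η * Real.log p := by positivity
    have e4 : Real.exp (-(η * Real.log p)) ≤ 1 := Real.exp_le_one_iff.2 (by linarith)
    have e5 : 0 < 1 - a * Real.exp (-(η * Real.log p)) := by nlinarith
    have e6 := Real.add_one_le_exp (2 * η * (Real.log p / p))
    rw [e1, ← div_eq_mul_inv, le_div_iff₀ e5, inv_mul_le_iff₀ (by linarith)]
    have e7 : Real.log p / p = Real.log p * a := div_eq_mul_inv _ _
    rw [e7] at e6 ⊢
    have e8 : 0 ≤ η * Real.log p * a := by positivity
    nlinarith [mul_le_mul_of_nonneg_left e6 (show 0 ≤ 1 - a by linarith)]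
  have h1 : ∏ p ∈ s, (1 - (p : ℝ)⁻¹)⁻¹ ≤
      ∏ p ∈ s, (Real.exp (2 * η * (Real.log p / p)) * (1 - (p : ℝ) ^ (-(1 + η)))⁻¹) := by
    refine Finset.prod_le_prod (fun p hp => ?_) hterm
    have := prime_inv_le_half (hs p hp).1
    exact inv_nonneg.2 (by linarith)
  refine h1.trans ?_
  rw [Finset.prod_mul_distrib, ← Real.exp_sum, ← Finset.mul_sum, mul_assoc 2 η]
  have h2 := sum_prime_log_div_le (by linarith) hs
  have h3 := prod_prime_one_sub_rpow_inv_le hη fun p hp => (hs p hp).1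
  have h4 : η * (1 + Real.log x) = 1 / Real.log x + 1 := by
    rw [hηdef]; field_simp
  have h5 : 1 / Real.log x ≤ 1 / Real.log 2 := by gcongr
  have h6 : 1 + 1 / η ≤ (1 / Real.log 2 + 1) * Real.log x := by
    rw [hηdef, one_div_one_div]
    have : 1 ≤ 1 / Real.log 2 * Real.log x := by
      rw [div_mul_eq_mul_div, le_div_iff₀ hl2]; linarith
    linarith
  rw [mul_assoc (Real.exp _)]
  refine mul_le_mul (Real.exp_le_exp.2 ?_) (h3.trans h6) ?_ (Real.exp_pos _).le
  · have : η * ∑ p ∈ s, Real.log p / p ≤ η * (Real.log 4 * (1 + Real.log x)) := by gcongr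
    have e : η * (Real.log 4 * (1 + Real.log x)) = Real.log 4 * (1 / Real.log x + 1) := by
      rw [← h4]; ring
    have e' : Real.log 4 * (1 / Real.log x + 1) ≤ Real.log 4 * (1 / Real.log 2 + 1) := by gcongr
    nlinarith
  · refine Finset.prod_nonneg fun p hp => inv_nonneg.2 ?_
    have : (p : ℝ) ^ (-(1 + η)) < 1 :=
      Real.rpow_lt_one_of_one_lt_of_neg (by exact_mod_cast (hs p hp).1.one_lt) (by linarith)
    linarith

/-- The Mertens product over a range of primes `(y, x]`. -/
theorem prod_prime_Ioc_one_sub_inv_le {x y : ℝ} (hx : 1 ≤ x) (hy : 1 < y) {s : Finset ℕ}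
    (hs : ∀ p ∈ s, p.Prime ∧ (p : ℝ) ≤ x ∧ y ≤ p) :
    ∏ p ∈ s, (1 - (p : ℝ)⁻¹)⁻¹ ≤
      Real.exp (2 * (Real.log 4 * (1 + Real.log x) / Real.log y)) := by
  have hly : 0 < Real.log y := Real.log_pos hy
  have hterm : ∀ p ∈ s, (1 - (p : ℝ)⁻¹)⁻¹ ≤
      Real.exp (2 * (Real.log y)⁻¹ * (Real.log p / p)) := by
    intro p hp
    obtain ⟨hpp, -, hyp⟩ := hs p hp
    have hp0 : (0 : ℝ) < p := by exact_mod_cast hpp.pos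
    have hpi := prime_inv_le_half hpp
    have hl : Real.log y ≤ Real.log p := Real.log_le_log (by linarith) hyp
    have e1 : 1 ≤ (Real.log y)⁻¹ * Real.log p := by
      rw [inv_mul_eq_div, le_div_iff₀ hly]; linarith
    have e2 : 2 * (p : ℝ)⁻¹ ≤ 2 * (Real.log y)⁻¹ * (Real.log p / p) := by
      have : 0 < (p : ℝ)⁻¹ := by positivity
      rw [div_eq_mul_inv]
      nlinarith
    have e3 := Real.add_one_le_exp (2 * (Real.log y)⁻¹ * (Real.log p / p))
    rw [inv_le_iff_one_le_mul₀ (by linarith)]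
    have : 0 < (p : ℝ)⁻¹ := by positivity
    nlinarith
  have h1 : ∏ p ∈ s, (1 - (p : ℝ)⁻¹)⁻¹ ≤
      ∏ p ∈ s, Real.exp (2 * (Real.log y)⁻¹ * (Real.log p / p)) := by
    refine Finset.prod_le_prod (fun p hp => ?_) hterm
    have := prime_inv_le_half (hs p hp).1
    exact inv_nonneg.2 (by linarith)
  refine h1.trans ?_
  rw [← Real.exp_sum, ← Finset.mul_sum]
  have h2 := sum_prime_log_div_le hx fun p hp => ⟨(hs p hp).1, (hs p hp).2.1⟩
  apply Real.exp_le_exp.2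
  calc _ ≤ 2 * (Real.log y)⁻¹ * (Real.log 4 * (1 + Real.log x)) := by gcongr
    _ = _ := by rw [div_eq_mul_inv]; ring

/-! ### Selberg's upper bound sieve -/

open ArithmeticFunction in
-- Möbius inversion among the divisors between l and k: with d = le and k = lj it reduces to ∑ μ(e)
-- = 0 over e ∣ j, unless j = 1. It serves to diagonalise Selberg's quadratic form.
theorem sum_moebius_between {P l k : ℕ} (hP : Squarefree P) (hk : k ∣ P) :
    ∑ d ∈ P.divisors with l ∣ d ∧ d ∣ k, (moebius d : ℝ) = if k = l then (moebius l : ℝ) else 0 := by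
  have hP0 := hP.ne_zero
  have hksq := hP.squarefree_of_dvd hk
  by_cases hlk : l ∣ k
  · obtain ⟨j, rfl⟩ := hlk
    have hl0 : l ≠ 0 := left_ne_zero_of_mul hksq.ne_zero
    have hj0 : j ≠ 0 := right_ne_zero_of_mul hksq.ne_zero
    have hset : P.divisors.filter (fun d => l ∣ d ∧ d ∣ l * j) = j.divisors.image (l * ·) := by
      ext d
      simp only [mem_filter, Nat.mem_divisors, mem_image]
      constructor
      · rintro ⟨-, ⟨e, rfl⟩, h⟩
        exact ⟨e, ⟨Nat.dvd_of_mul_dvd_mul_left (Nat.pos_of_ne_zero hl0) h, hj0⟩, rfl⟩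
      · rintro ⟨e, ⟨he, -⟩, rfl⟩
        exact ⟨⟨(Nat.mul_dvd_mul_left l he).trans hk, hP0⟩, dvd_mul_right _ _,
          Nat.mul_dvd_mul_left l he⟩
    rw [hset, Finset.sum_image fun a _ b _ h => Nat.eq_of_mul_eq_mul_left (Nat.pos_of_ne_zero hl0) h]
    have hmul : ∀ e ∈ j.divisors, (moebius (l * e) : ℝ) = moebius l * moebius e := by
      intro e he
      have hcop : Nat.Coprime l e := by
        have : Squarefree (l * e) :=
          hksq.squarefree_of_dvd (Nat.mul_dvd_mul_left l (Nat.dvd_of_mem_divisors he))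
        exact Nat.coprime_of_squarefree_mul this
      rw [isMultiplicative_moebius.map_mul_of_coprime hcop]
      push_cast; rfl
    rw [Finset.sum_congr rfl hmul, ← Finset.mul_sum]
    have hsum : ∑ e ∈ j.divisors, (moebius e : ℝ) = if j = 1 then 1 else 0 := by
      have h := congrArg (fun f => f j) moebius_mul_coe_zeta
      simp only [coe_mul_zeta_apply, one_apply] at h
      exact_mod_cast h
    rw [hsum]
    have : l * j = l ↔ j = 1 := by
      constructor
      · intro h; exact Nat.eq_of_mul_eq_mul_left (Nat.pos_of_ne_zero hl0) (by simpa using h)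
      · rintro rfl; simp
    simp [this]
  · rw [Finset.filter_false_of_mem, Finset.sum_empty, if_neg]
    · rintro rfl; exact hlk dvd_rfl
    · rintro d - ⟨h1, h2⟩; exact hlk (h1.trans h2)

/-- The sum `∑ 1 / φ(d)` over the divisors `d ≤ ξ` of `P`, the denominator in Selberg's sieve. -/
noncomputable def selbergSum (P : ℕ) (ξ : ℝ) : ℝ :=
  ∑ d ∈ P.divisors with ((d : ℕ) : ℝ) ≤ ξ, ((d.totient : ℝ))⁻¹

/-- Selberg's optimal weights for the linear density `d ↦ 1 / d`. -/
noncomputable def selbergWeight (P : ℕ) (ξ : ℝ) (d : ℕ) : ℝ :=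
  (ArithmeticFunction.moebius d : ℝ) * d / selbergSum P ξ *
    ∑ k ∈ P.divisors with d ∣ k ∧ ((k : ℕ) : ℝ) ≤ ξ, ((k.totient : ℝ))⁻¹

theorem selbergSum_pos {P : ℕ} {ξ : ℝ} (hP : P ≠ 0) (hξ : 1 ≤ ξ) : 0 < selbergSum P ξ := by
  refine Finset.sum_pos' (fun d _ => by positivity) ⟨1, ?_, by simp⟩
  simp [hP, hξ]

theorem selbergWeight_one {P : ℕ} {ξ : ℝ} (hP : P ≠ 0) (hξ : 1 ≤ ξ) :
    selbergWeight P ξ 1 = 1 := by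
  have h := (selbergSum_pos hP hξ).ne'
  have h1 : ∑ k ∈ P.divisors with 1 ∣ k ∧ ((k : ℕ) : ℝ) ≤ ξ, ((k.totient : ℝ))⁻¹ =
      selbergSum P ξ := by simp [selbergSum]
  rw [selbergWeight, h1]
  simp [h]

theorem selbergWeight_eq_zero {P d : ℕ} {ξ : ℝ} (hd : ξ < d) :
    selbergWeight P ξ d = 0 := by
  rw [selbergWeight, Finset.filter_false_of_mem, Finset.sum_empty, mul_zero]
  rintro k hk ⟨h1, h2⟩
  have hk0 : 0 < k := Nat.pos_of_mem_divisors hk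
  have : (d : ℝ) ≤ k := by exact_mod_cast Nat.le_of_dvd hk0 h1
  linarith

/-- Expand d = ∑ φ(l) over l ∣ d and use φ(l)/φ(k) = 1/φ(k/l). The map (k, l) ↦ k/l is injective,
since l is the part of d prime to k/l, so the terms appear without repetition in `selbergSum`. This
is what makes the weights bounded by 1. -/
theorem mul_sum_inv_totient_le {P d : ℕ} {ξ : ℝ} (hP : Squarefree P) (hd : d ∣ P) :
    (d : ℝ) * ∑ k ∈ P.divisors with d ∣ k ∧ ((k : ℕ) : ℝ) ≤ ξ, ((k.totient : ℝ))⁻¹ ≤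
      selbergSum P ξ := by
  have hP0 := hP.ne_zero
  have hd0 : d ≠ 0 := ne_zero_of_dvd_ne_zero hP0 hd
  set A := P.divisors.filter (fun k => d ∣ k ∧ ((k : ℕ) : ℝ) ≤ ξ) with hA
  have hprop : ∀ x ∈ A ×ˢ d.divisors, ∃ m, x.1 = x.2 * m ∧ d ∣ x.2 * m ∧ x.2 ∣ d ∧ x.2 * m ∣ P ∧
      x.2.Coprime m ∧ 0 < x.2 ∧ 0 < m ∧ ((x.2 * m : ℕ) : ℝ) ≤ ξ := by
    rintro ⟨k, l⟩ hx
    simp only [hA, mem_product, mem_filter, Nat.mem_divisors] at hx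
    obtain ⟨⟨⟨hkP, -⟩, hdk, hkξ⟩, hld, -⟩ := hx
    obtain ⟨m, rfl⟩ := hld.trans hdk
    have hsq := hP.squarefree_of_dvd hkP
    exact ⟨m, rfl, hdk, hld, hkP, Nat.coprime_of_squarefree_mul hsq,
      Nat.pos_of_ne_zero (left_ne_zero_of_mul hsq.ne_zero),
      Nat.pos_of_ne_zero (right_ne_zero_of_mul hsq.ne_zero), hkξ⟩
  have h1 : (d : ℝ) * ∑ k ∈ A, ((k.totient : ℝ))⁻¹ =
      ∑ x ∈ A ×ˢ d.divisors, (((x.1 / x.2).totient : ℝ))⁻¹ := by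
    have : (d : ℝ) = ∑ l ∈ d.divisors, (l.totient : ℝ) := by exact_mod_cast (Nat.sum_totient d).symm
    rw [this, mul_comm, Finset.sum_mul_sum, ← Finset.sum_product']
    refine Finset.sum_congr rfl fun x hx => ?_
    obtain ⟨m, h, -, -, -, hc, hl, hm, -⟩ := hprop x hx
    rw [h, Nat.mul_div_cancel_left _ hl, Nat.totient_mul hc]
    have : (x.2.totient : ℝ) ≠ 0 := by exact_mod_cast (Nat.totient_pos.2 hl).ne'
    push_cast
    field_simp
  have hinj : Set.InjOn (fun x : ℕ × ℕ => x.1 / x.2) (A ×ˢ d.divisors : Finset (ℕ × ℕ)) := by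
    intro x hx y hy hxy
    obtain ⟨m, h, hd1, hd2, -, hc, hl, hm, -⟩ := hprop x hx
    obtain ⟨m', h', hd1', hd2', -, hc', hl', hm', -⟩ := hprop y hy
    simp only [h, h', Nat.mul_div_cancel_left _ hl, Nat.mul_div_cancel_left _ hl'] at hxy
    subst hxy
    have e1 : x.2 ∣ y.2 := hc.dvd_of_dvd_mul_right (hd2.trans hd1')
    have e2 : y.2 ∣ x.2 := hc'.dvd_of_dvd_mul_right (hd2'.trans hd1)
    have e := Nat.dvd_antisymm e1 e2
    exact Prod.ext (by rw [h, h', e]) e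
  rw [h1, ← Finset.sum_image (f := fun m : ℕ => ((m.totient : ℝ))⁻¹) hinj, selbergSum]
  refine Finset.sum_le_sum_of_subset_of_nonneg (fun m hm => ?_) fun m _ _ => by positivity
  obtain ⟨x, hx, rfl⟩ := Finset.mem_image.1 hm
  obtain ⟨m, h, -, -, hmP, -, hl, hm, hξ⟩ := hprop x hx
  simp only [h, Nat.mul_div_cancel_left _ hl, mem_filter, Nat.mem_divisors]
  refine ⟨⟨(dvd_mul_left _ _).trans hmP, hP0⟩, le_trans ?_ hξ⟩
  exact_mod_cast Nat.le_mul_of_pos_left m hl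

theorem abs_selbergWeight_le {P d : ℕ} {ξ : ℝ} (hP : Squarefree P) (hξ : 1 ≤ ξ) (hd : d ∣ P) :
    |selbergWeight P ξ d| ≤ 1 := by
  have hG := selbergSum_pos hP.ne_zero hξ
  have h := mul_sum_inv_totient_le (ξ := ξ) hP hd
  have hμ : |(ArithmeticFunction.moebius d : ℝ)| ≤ 1 := by
    exact_mod_cast ArithmeticFunction.abs_moebius_le_one
  set X := ∑ k ∈ P.divisors with d ∣ k ∧ ((k : ℕ) : ℝ) ≤ ξ, ((k.totient : ℝ))⁻¹ with hX
  have hX0 : 0 ≤ X := Finset.sum_nonneg fun k _ => by positivity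
  have e : selbergWeight P ξ d =
      (ArithmeticFunction.moebius d : ℝ) * ((d : ℝ) * X / selbergSum P ξ) := by
    rw [selbergWeight, ← hX]; ring
  rw [e, abs_mul, abs_of_nonneg (show 0 ≤ (d : ℝ) * X / selbergSum P ξ by positivity)]
  have : (d : ℝ) * X / selbergSum P ξ ≤ 1 := (div_le_one hG).2 h
  exact mul_le_one₀ hμ (by positivity) this

theorem sum_selbergWeight_div {P l : ℕ} {ξ : ℝ} (hP : Squarefree P) (hl : l ∣ P) :
    ∑ d ∈ P.divisors with l ∣ d, selbergWeight P ξ d / d =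
      if (l : ℝ) ≤ ξ then (ArithmeticFunction.moebius l : ℝ) / selbergSum P ξ *
        ((l.totient : ℝ))⁻¹ else 0 := by
  have h1 : ∀ d ∈ P.divisors.filter (fun d => l ∣ d), selbergWeight P ξ d / d =
      ∑ k ∈ P.divisors.filter (fun k => ((k : ℕ) : ℝ) ≤ ξ),
        if d ∣ k then (ArithmeticFunction.moebius d : ℝ) *
          ((selbergSum P ξ)⁻¹ * ((k.totient : ℝ))⁻¹) else 0 := by
    intro d hd
    have hd0 : (d : ℝ) ≠ 0 := by
      exact_mod_cast (Nat.pos_of_mem_divisors (Finset.mem_filter.1 hd).1).ne'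
    rw [← Finset.sum_filter, Finset.filter_filter, ← Finset.mul_sum, ← Finset.mul_sum,
      selbergWeight]
    simp only [and_comm]
    field_simp
  rw [Finset.sum_congr rfl h1, Finset.sum_comm]
  have h2 : ∀ k ∈ P.divisors.filter (fun k => ((k : ℕ) : ℝ) ≤ ξ),
      ∑ d ∈ P.divisors.filter (fun d => l ∣ d),
        (if d ∣ k then (ArithmeticFunction.moebius d : ℝ) *
          ((selbergSum P ξ)⁻¹ * ((k.totient : ℝ))⁻¹) else 0) =
      if k = l then (ArithmeticFunction.moebius l : ℝ) *
          ((selbergSum P ξ)⁻¹ * ((l.totient : ℝ))⁻¹) else 0 := by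
    intro k hk
    rw [← Finset.sum_filter, Finset.filter_filter, ← Finset.sum_mul,
      sum_moebius_between hP (Nat.dvd_of_mem_divisors (Finset.mem_filter.1 hk).1)]
    split_ifs with h
    · rw [h]
    · rw [zero_mul]
  rw [Finset.sum_congr rfl h2, Finset.sum_ite_eq']
  simp only [mem_filter, Nat.mem_divisors, hl, hP.ne_zero, ne_eq, not_false_eq_true, and_self,
    true_and]
  split_ifs
  · ring
  · rfl

/-- Since 1/lcm(d, e) = gcd(d, e)/(de) and gcd(d, e) = ∑ φ(l) over common divisors l, the form is ∑
φ(l) y_l². Here y_l = μ(l)/(G φ(l)) for l ≤ ξ and 0 otherwise, by `sum_selbergWeight_div`, with G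
the Selberg sum. -/
theorem sum_sum_selbergWeight {P : ℕ} {ξ : ℝ} (hP : Squarefree P) (hξ : 1 ≤ ξ) :
    ∑ d ∈ P.divisors, ∑ e ∈ P.divisors,
      selbergWeight P ξ d * selbergWeight P ξ e / (d.lcm e : ℝ) = (selbergSum P ξ)⁻¹ := by
  have hG := (selbergSum_pos hP.ne_zero hξ).ne'
  have h1 : ∀ d ∈ P.divisors, ∀ e ∈ P.divisors,
      selbergWeight P ξ d * selbergWeight P ξ e / (d.lcm e : ℝ) =
      ∑ l ∈ P.divisors, (l.totient : ℝ) * ((if l ∣ d then selbergWeight P ξ d / d else 0) *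
        (if l ∣ e then selbergWeight P ξ e / e else 0)) := by
    intro d hd e he
    have hd0 := (Nat.pos_of_mem_divisors hd)
    have he0 := (Nat.pos_of_mem_divisors he)
    have hs : ∑ l ∈ P.divisors, (l.totient : ℝ) *
        ((if l ∣ d then selbergWeight P ξ d / d else 0) *
        (if l ∣ e then selbergWeight P ξ e / e else 0)) =
        ∑ l ∈ (d.gcd e).divisors, (l.totient : ℝ) *
          (selbergWeight P ξ d / d * (selbergWeight P ξ e / e)) := by
      rw [← Nat.divisors_filter_dvd_of_dvd hP.ne_zero
        ((Nat.gcd_dvd_left d e).trans (Nat.dvd_of_mem_divisors hd)), Finset.sum_filter]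
      refine Finset.sum_congr rfl fun l _ => ?_
      by_cases hld : l ∣ d <;> by_cases hle : l ∣ e <;> simp [hld, hle, Nat.dvd_gcd_iff]
    rw [hs, ← Finset.sum_mul]
    have hg : ∑ l ∈ (d.gcd e).divisors, (l.totient : ℝ) = (d.gcd e : ℝ) := by
      exact_mod_cast Nat.sum_totient _
    have hgl : (d.gcd e : ℝ) * (d.lcm e : ℝ) = d * e := by exact_mod_cast Nat.gcd_mul_lcm d e
    have hl0 : (d.lcm e : ℝ) ≠ 0 := by exact_mod_cast (Nat.lcm_pos hd0 he0).ne'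
    have hd1 : (d : ℝ) ≠ 0 := by positivity
    have he1 : (e : ℝ) ≠ 0 := by positivity
    rw [hg]
    field_simp
    linear_combination (-selbergWeight P ξ d * selbergWeight P ξ e) * hgl
  rw [Finset.sum_congr rfl fun d hd => Finset.sum_congr rfl (h1 d hd)]
  have h2 : ∑ d ∈ P.divisors, ∑ e ∈ P.divisors, ∑ l ∈ P.divisors,
      (l.totient : ℝ) * ((if l ∣ d then selbergWeight P ξ d / d else 0) *
        (if l ∣ e then selbergWeight P ξ e / e else 0)) =
      ∑ l ∈ P.divisors, (l.totient : ℝ) *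
        (∑ d ∈ P.divisors with l ∣ d, selbergWeight P ξ d / d) ^ 2 := by
    rw [Finset.sum_congr rfl fun d _ => Finset.sum_comm, Finset.sum_comm]
    refine Finset.sum_congr rfl fun l _ => ?_
    rw [sq, Finset.sum_filter, Finset.sum_mul_sum, Finset.mul_sum]
    exact Finset.sum_congr rfl fun d _ => by rw [Finset.mul_sum]
  have h3 : ∀ l ∈ P.divisors, (l.totient : ℝ) *
        (∑ d ∈ P.divisors with l ∣ d, selbergWeight P ξ d / d) ^ 2 =
      if (l : ℝ) ≤ ξ then ((selbergSum P ξ) ^ 2)⁻¹ * ((l.totient : ℝ))⁻¹ else 0 := by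
    intro l hl
    have hl0 := Nat.pos_of_mem_divisors hl
    have hlP := Nat.dvd_of_mem_divisors hl
    rw [sum_selbergWeight_div hP hlP]
    split_ifs
    · have hμ : (ArithmeticFunction.moebius l : ℝ) ^ 2 = 1 := by
        have := ArithmeticFunction.moebius_sq_eq_one_of_squarefree (hP.squarefree_of_dvd hlP)
        exact_mod_cast this
      have ht : (l.totient : ℝ) ≠ 0 := by exact_mod_cast (Nat.totient_pos.2 hl0).ne'
      field_simp
      exact hμ
    · simp
  rw [h2, Finset.sum_congr rfl h3, ← Finset.sum_filter, ← Finset.mul_sum, ← selbergSum]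
  field_simp

/-- Selberg's sieve for a set of integers equidistributed, up to `O(1)`, in the multiples of
each `d`. -/
theorem card_coprime_le_selberg {P : ℕ} (hP : Squarefree P) {I : Finset ℤ} {Y ξ : ℝ}
    (hξ : 1 ≤ ξ) (hI : ∀ d : ℕ, 1 ≤ d → |(#{n ∈ I | (d : ℤ) ∣ n} : ℝ) - Y / d| ≤ 1) :
    (#{n ∈ I | n.natAbs.Coprime P} : ℝ) ≤ Y / selbergSum P ξ + ξ ^ 2 := by
  set w := selbergWeight P ξ with hw
  have hP0 := hP.ne_zero
  -- As the weight at 1 is 1, the square of the weighted divisor sum majorises the indicator of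
  -- being prime to P.
  have h1 : (#{n ∈ I | n.natAbs.Coprime P} : ℝ) ≤
      ∑ n ∈ I, (∑ d ∈ P.divisors, if (d : ℤ) ∣ n then w d else 0) ^ 2 := by
    rw [Finset.card_filter]
    push_cast
    refine Finset.sum_le_sum fun n _ => ?_
    split_ifs with hn
    · rw [Finset.sum_eq_single 1]
      · simp [hw, selbergWeight_one hP0 hξ]
      · intro d hd hd1
        rw [if_neg]
        intro hdn
        have h := Nat.dvd_gcd (Int.natCast_dvd.1 hdn) (Nat.dvd_of_mem_divisors hd)
        rw [hn.gcd_eq_one] at h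
        exact hd1 (Nat.dvd_one.1 h)
      · simp [hP0]
    · positivity
  have h2 : ∑ n ∈ I, (∑ d ∈ P.divisors, if (d : ℤ) ∣ n then w d else 0) ^ 2 =
      ∑ d ∈ P.divisors, ∑ e ∈ P.divisors,
        w d * w e * (#{n ∈ I | ((d.lcm e : ℕ) : ℤ) ∣ n} : ℝ) := by
    simp_rw [sq, Finset.sum_mul_sum]
    rw [Finset.sum_comm]
    refine Finset.sum_congr rfl fun d _ => ?_
    rw [Finset.sum_comm]
    refine Finset.sum_congr rfl fun e _ => ?_
    rw [Finset.card_filter]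
    push_cast
    rw [Finset.mul_sum]
    refine Finset.sum_congr rfl fun n _ => ?_
    have : ((d.lcm e : ℕ) : ℤ) ∣ n ↔ (d : ℤ) ∣ n ∧ (e : ℤ) ∣ n := by
      simp only [Int.natCast_dvd, Nat.lcm_dvd_iff]
    by_cases hd : (d : ℤ) ∣ n <;> by_cases he : (e : ℤ) ∣ n <;> simp [hd, he, this]
  have h3 : ∀ d ∈ P.divisors, ∀ e ∈ P.divisors,
      w d * w e * (#{n ∈ I | ((d.lcm e : ℕ) : ℤ) ∣ n} : ℝ) ≤
        Y * (w d * w e / (d.lcm e : ℝ)) + |w d| * |w e| := by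
    intro d hd e he
    have hl := Nat.lcm_pos (Nat.pos_of_mem_divisors hd) (Nat.pos_of_mem_divisors he)
    have h := hI (d.lcm e) hl
    have e1 : w d * w e * ((#{n ∈ I | ((d.lcm e : ℕ) : ℤ) ∣ n} : ℝ) - Y / (d.lcm e : ℕ)) ≤
        |w d| * |w e| := by
      refine (le_abs_self _).trans ?_
      rw [abs_mul, abs_mul]
      exact mul_le_of_le_one_right (by positivity) h
    have e2 : Y * (w d * w e / (d.lcm e : ℝ)) = w d * w e * (Y / (d.lcm e : ℕ)) := by ring
    rw [e2]; linarith
  -- The O(1) errors add up to (∑ |w d|)², and at most ξ divisors carry a nonzero weight, each of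
  -- size at most 1.
  have h4 : ∑ d ∈ P.divisors, ∑ e ∈ P.divisors, |w d| * |w e| ≤ ξ ^ 2 := by
    rw [← Finset.sum_mul_sum, ← sq]
    have h5 : ∑ d ∈ P.divisors, |w d| ≤ ξ := by
      have h6 : ∀ d ∈ P.divisors, |w d| ≤ if (d : ℝ) ≤ ξ then 1 else 0 := by
        intro d hd
        split_ifs with hdξ
        · exact abs_selbergWeight_le hP hξ (Nat.dvd_of_mem_divisors hd)
        · rw [hw, selbergWeight_eq_zero (not_le.1 hdξ), abs_zero]
      refine (Finset.sum_le_sum h6).trans ?_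
      rw [← Finset.sum_filter, Finset.sum_const, nsmul_eq_mul, mul_one]
      have h7 : P.divisors.filter (fun d => ((d : ℕ) : ℝ) ≤ ξ) ⊆ Icc 1 ⌊ξ⌋₊ := by
        intro d hd
        obtain ⟨hd1, hd2⟩ := Finset.mem_filter.1 hd
        exact Finset.mem_Icc.2 ⟨Nat.pos_of_mem_divisors hd1, Nat.le_floor hd2⟩
      have h8 := Finset.card_le_card h7
      rw [Nat.card_Icc, Nat.add_sub_cancel] at h8
      exact (Nat.cast_le.2 h8).trans (Nat.floor_le (by linarith))
    have : 0 ≤ ∑ d ∈ P.divisors, |w d| := Finset.sum_nonneg fun d _ => abs_nonneg _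
    gcongr
  refine h1.trans (h2.le.trans ((Finset.sum_le_sum fun d hd => Finset.sum_le_sum (h3 d hd)).trans ?_))
  simp_rw [Finset.sum_add_distrib, ← Finset.mul_sum]
  rw [hw, sum_sum_selbergWeight hP hξ, ← div_eq_mul_inv]
  simp_rw [Finset.mul_sum]
  linarith

/-! ### The denominator of Selberg's sieve and the fundamental lemma -/

theorem sum_rpow_div_totient_eq_prod {P : ℕ} (hP : Squarefree P) (κ : ℝ) :
    ∑ d ∈ P.divisors, (d : ℝ) ^ κ * ((d.totient : ℝ))⁻¹ =
      ∏ p ∈ P.primeFactors, (1 + (p : ℝ) ^ κ * ((p : ℝ) - 1)⁻¹) := by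
  let f : ArithmeticFunction ℝ := ⟨fun d => (d : ℝ) ^ κ * ((d.totient : ℝ))⁻¹, by simp⟩
  have hf : f.IsMultiplicative := by
    refine ⟨by simp [f], fun {m n} h => ?_⟩
    simp only [f, ArithmeticFunction.coe_mk, Nat.totient_mul h]
    push_cast
    rw [Real.mul_rpow (by positivity) (by positivity), mul_inv]
    ring
  have h := hf.prodPrimeFactors_one_add_of_squarefree hP
  simp only [f, ArithmeticFunction.coe_mk] at h
  rw [← h]
  refine Finset.prod_congr rfl fun p hp => ?_
  have hp := Nat.prime_of_mem_primeFactors hp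
  rw [Nat.totient_prime hp, Nat.cast_sub hp.one_lt.le, Nat.cast_one]

theorem one_sub_prime_inv_pos {p : ℕ} (hp : p.Prime) : 0 < 1 - (p : ℝ)⁻¹ := by
  have := prime_inv_le_half hp
  linarith

theorem prod_one_sub_inv_mul_sum_rpow {P : ℕ} (hP : Squarefree P) (κ : ℝ) :
    (∏ p ∈ P.primeFactors, (1 - (p : ℝ)⁻¹)) *
      ∑ d ∈ P.divisors, (d : ℝ) ^ κ * ((d.totient : ℝ))⁻¹ =
      ∏ p ∈ P.primeFactors, (1 + ((p : ℝ) ^ κ - 1) / p) := by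
  rw [sum_rpow_div_totient_eq_prod hP, ← Finset.prod_mul_distrib]
  refine Finset.prod_congr rfl fun p hp => ?_
  have hp := Nat.prime_of_mem_primeFactors hp
  have h1 : (1 : ℝ) < p := by exact_mod_cast hp.one_lt
  have h2 : (p : ℝ) - 1 ≠ 0 := by linarith
  field_simp
  ring

theorem prod_one_sub_inv_mul_sum_inv_totient {P : ℕ} (hP : Squarefree P) :
    (∏ p ∈ P.primeFactors, (1 - (p : ℝ)⁻¹)) * ∑ d ∈ P.divisors, ((d.totient : ℝ))⁻¹ = 1 := by
  have h := prod_one_sub_inv_mul_sum_rpow hP 0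
  simpa using h

theorem prod_one_sub_inv_pos (P : ℕ) : 0 < ∏ p ∈ P.primeFactors, (1 - (p : ℝ)⁻¹) :=
  Finset.prod_pos fun _ hp => one_sub_prime_inv_pos (Nat.prime_of_mem_primeFactors hp)

/-- Rankin's trick for the tail of `selbergSum`. -/
theorem one_sub_le_prod_mul_selbergSum {P : ℕ} (hP : Squarefree P) {κ ξ : ℝ} (hκ : 0 ≤ κ)
    (hξ : 0 < ξ) :
    1 - Real.exp (-(κ * Real.log ξ) + ∑ p ∈ P.primeFactors, ((p : ℝ) ^ κ - 1) / p) ≤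
      (∏ p ∈ P.primeFactors, (1 - (p : ℝ)⁻¹)) * selbergSum P ξ := by
  set V := ∏ p ∈ P.primeFactors, (1 - (p : ℝ)⁻¹) with hV
  have hV0 : 0 < V := prod_one_sub_inv_pos P
  have h1 := prod_one_sub_inv_mul_sum_inv_totient hP
  rw [← hV, ← Finset.sum_filter_add_sum_filter_not _ (fun d : ℕ => (d : ℝ) ≤ ξ), mul_add] at h1
  have h2 : ∑ d ∈ P.divisors with ¬ ((d : ℕ) : ℝ) ≤ ξ, ((d.totient : ℝ))⁻¹ ≤
      Real.exp (-(κ * Real.log ξ)) * ∑ d ∈ P.divisors, (d : ℝ) ^ κ * ((d.totient : ℝ))⁻¹ := by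
    rw [Finset.mul_sum]
    refine (Finset.sum_le_sum fun d hd => ?_).trans
      (Finset.sum_le_sum_of_subset_of_nonneg (Finset.filter_subset _ _) fun d _ _ => by positivity)
    have hd' := not_le.1 (Finset.mem_filter.1 hd).2
    rw [← mul_assoc]
    refine le_mul_of_one_le_left (by positivity) ?_
    rw [Real.rpow_def_of_pos (hξ.trans hd'), ← Real.exp_add]
    apply Real.one_le_exp
    have := Real.log_le_log hξ hd'.le
    nlinarith
  have h3 : V * ∑ d ∈ P.divisors, (d : ℝ) ^ κ * ((d.totient : ℝ))⁻¹ ≤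
      Real.exp (∑ p ∈ P.primeFactors, ((p : ℝ) ^ κ - 1) / p) := by
    rw [hV, prod_one_sub_inv_mul_sum_rpow hP, Real.exp_sum]
    refine Finset.prod_le_prod (fun p hp => ?_) fun p hp => ?_
    · have h1 : (1 : ℝ) ≤ p := by
        exact_mod_cast (Nat.prime_of_mem_primeFactors hp).one_lt.le
      have := Real.one_le_rpow h1 hκ
      have : 0 ≤ ((p : ℝ) ^ κ - 1) / p := div_nonneg (by linarith) (by linarith)
      linarith
    · linarith [Real.add_one_le_exp (((p : ℝ) ^ κ - 1) / p)]
  have h4 : V * ∑ d ∈ P.divisors with ¬ ((d : ℕ) : ℝ) ≤ ξ, ((d.totient : ℝ))⁻¹ ≤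
      Real.exp (-(κ * Real.log ξ) + ∑ p ∈ P.primeFactors, ((p : ℝ) ^ κ - 1) / p) := by
    rw [Real.exp_add]
    calc _ ≤ V * (Real.exp (-(κ * Real.log ξ)) *
          ∑ d ∈ P.divisors, (d : ℝ) ^ κ * ((d.totient : ℝ))⁻¹) := by gcongr
      _ = Real.exp (-(κ * Real.log ξ)) *
          (V * ∑ d ∈ P.divisors, (d : ℝ) ^ κ * ((d.totient : ℝ))⁻¹) := by ring
      _ ≤ _ := by gcongr
  rw [selbergSum]
  linarith

theorem log_le_of_primeFactors_le {P : ℕ} (hP : Squarefree P) {x : ℝ} (hx : 0 ≤ x)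
    (hPx : ∀ p ∈ P.primeFactors, (p : ℝ) ≤ x) : Real.log P ≤ Real.log 4 * x := by
  have h := sum_prime_log_mul_le (f := fun _ => 1) (fun _ => zero_le_one) (fun _ _ => le_rfl)
    (s := P.primeFactors) fun p hp => ⟨Nat.prime_of_mem_primeFactors hp, hPx p hp⟩
  simp only [mul_one, sum_const, Nat.card_Icc, Nat.add_sub_cancel, nsmul_eq_mul] at h
  have h1 : Real.log P = ∑ p ∈ P.primeFactors, Real.log p := by
    conv_lhs => rw [← Nat.prod_primeFactors_of_squarefree hP]
    push_cast
    rw [Real.log_prod]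
    intro p hp
    exact_mod_cast (Nat.prime_of_mem_primeFactors hp).ne_zero
  rw [h1]
  have h4 : 0 ≤ Real.log 4 := Real.log_nonneg (by norm_num)
  exact h.trans (by gcongr; exact Nat.floor_le hx)

/-- This is the bracket of `sum_prime_rpow_sub_one_div_le` at κ log x = log(16v). The first term has
order √v log v, hence is at most v. The second is 32v/log(16v) ≤ v/2, which is where log(16v) ≥ 64
is used. -/
theorem selberg_tail_exponent_le {v : ℝ} (hv : Real.exp 64 ≤ v) :
    Real.exp (Real.log (16 * v) / 2) * (1 + Real.log (16 * v)) +
        2 * (Real.exp (Real.log (16 * v)) / Real.log (16 * v)) ≤ 3 / 2 * v := by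
  have hv0 : 0 < v := (Real.exp_pos _).trans_le hv
  have hlv : 64 ≤ Real.log (16 * v) := by
    rw [Real.le_log_iff_exp_le (by positivity)]
    linarith
  set s := Real.exp (Real.log v / 4) with hs
  have hs0 : 0 < s := Real.exp_pos _
  have hs4 : s ^ 4 = v := by
    rw [hs, ← Real.exp_nat_mul, show ((4 : ℕ) : ℝ) * (Real.log v / 4) = Real.log v by
      push_cast; ring, Real.exp_log hv0]
  have hs36 : 36 ≤ s := by
    have h1 : Real.exp 16 ≤ s := by
      rw [hs]; apply Real.exp_le_exp.2
      have : 64 ≤ Real.log v := by rwa [Real.le_log_iff_exp_le hv0]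
      linarith
    have h2 : (2 : ℝ) ^ 16 ≤ Real.exp 16 := by
      rw [show (16 : ℝ) = ((16 : ℕ) : ℝ) * 1 by norm_num, Real.exp_nat_mul]
      have := Real.add_one_le_exp 1
      gcongr
      linarith
    norm_num at h2
    linarith
  have h2s : 16 * v = (2 * s) ^ 4 := by rw [mul_pow, hs4]; norm_num
  have hlog : Real.log (16 * v) ≤ 8 * s := by
    rw [h2s, Real.log_pow]
    have := Real.log_le_sub_one_of_pos (show 0 < 2 * s by positivity)
    push_cast
    linarith
  have hhalf : Real.exp (Real.log (16 * v) / 2) = 4 * s ^ 2 := by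
    rw [h2s, Real.log_pow, show ((4 : ℕ) : ℝ) * Real.log (2 * s) / 2 =
      ((2 : ℕ) : ℝ) * Real.log (2 * s) by push_cast; ring, Real.exp_nat_mul,
      Real.exp_log (by positivity)]
    ring
  have e1 : Real.exp (Real.log (16 * v) / 2) * (1 + Real.log (16 * v)) ≤ v := by
    rw [hhalf]
    calc 4 * s ^ 2 * (1 + Real.log (16 * v)) ≤ 4 * s ^ 2 * (1 + 8 * s) := by gcongr
      _ ≤ 36 * s ^ 3 := by nlinarith [pow_pos hs0 2]
      _ ≤ s * s ^ 3 := by gcongr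
      _ = v := by rw [← hs4]; ring
  have e2 : Real.exp (Real.log (16 * v)) / Real.log (16 * v) ≤ v / 4 := by
    rw [Real.exp_log (by positivity), div_le_iff₀ (by linarith)]
    nlinarith
  linarith

/-- If P ≤ x^v the Selberg sum is complete and the product is exactly 1. Otherwise Chebyshev's bound
log P ≤ x log 4 forces x to be large compared with v, and Rankin's trick applies with κ =
log(16v)/log x. -/
theorem one_sub_rpow_le_prod_mul_selbergSum {v x : ℝ} (hv : Real.exp 64 ≤ v) (hx : 1 < x)
    {P : ℕ} (hP : Squarefree P) (hPx : ∀ p ∈ P.primeFactors, (p : ℝ) ≤ x) :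
    1 - (2 * v) ^ (-v) ≤ (∏ p ∈ P.primeFactors, (1 - (p : ℝ)⁻¹)) * selbergSum P (x ^ v) := by
  have hv0 : 0 < v := (Real.exp_pos _).trans_le hv
  have hx0 : 0 < x := by linarith
  have hlx : 0 < Real.log x := Real.log_pos hx
  by_cases hPv : (P : ℝ) ≤ x ^ v
  · have h : selbergSum P (x ^ v) = ∑ d ∈ P.divisors, ((d.totient : ℝ))⁻¹ := by
      rw [selbergSum, Finset.filter_true_of_mem]
      intro d hd
      exact le_trans (by exact_mod_cast Nat.divisor_le hd) hPv
    rw [h, prod_one_sub_inv_mul_sum_inv_totient hP]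
    have : 0 ≤ (2 * v) ^ (-v) := by positivity
    linarith
  push Not at hPv
  have hl4 : 0 < Real.log 4 := Real.log_pos (by norm_num)
  have h2 : v * Real.log x < Real.log 4 * x := by
    have h3 := Real.log_lt_log (by positivity) hPv
    rw [Real.log_rpow hx0] at h3
    exact h3.trans_le (log_le_of_primeFactors_le hP hx0.le hPx)
  have hx2 : 2 ≤ x := by
    have hP1 : P ≠ 1 := by
      rintro rfl
      have : 1 ≤ x ^ v := Real.one_le_rpow hx.le hv0.le
      simp at hPv
      linarith
    have hmem : P.minFac ∈ P.primeFactors :=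
      Nat.mem_primeFactors.2 ⟨Nat.minFac_prime hP1, Nat.minFac_dvd P, hP.ne_zero⟩
    refine le_trans ?_ (hPx _ hmem)
    exact_mod_cast (Nat.minFac_prime hP1).two_le
  have hlog42 : Real.log 4 = 2 * Real.log 2 := by
    rw [show (4 : ℝ) = 2 ^ 2 by norm_num, Real.log_pow]; norm_num
  have hl2 : Real.log 2 ≤ Real.log x := Real.log_le_log (by norm_num) hx2
  -- This is what gives κ ≤ 1. If x < 16v, then v log x < x log 4 would give x < 4^16 and v < 2x,
  -- contradicting v ≥ exp 64 ≥ 2^64.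
  have hxv : 16 * v ≤ x := by
    by_contra! hcon
    have h4 : Real.log x < 16 * Real.log 4 := by
      have : v * Real.log x < v * (16 * Real.log 4) := by nlinarith
      exact lt_of_mul_lt_mul_left this hv0.le
    have h5 : x < 4 ^ 16 := by
      rw [show 16 * Real.log 4 = Real.log (4 ^ 16) by rw [Real.log_pow]; norm_num] at h4
      exact (Real.log_lt_log_iff hx0 (by norm_num)).1 h4
    have h6 : v < 2 * x := by
      have : v * Real.log 2 < 2 * x * Real.log 2 := by nlinarith
      exact lt_of_mul_lt_mul_right this (by linarith)
    have h7 : (2 : ℝ) ^ 64 ≤ Real.exp 64 := by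
      rw [show (64 : ℝ) = ((64 : ℕ) : ℝ) * 1 by norm_num, Real.exp_nat_mul]
      have := Real.add_one_le_exp 1
      gcongr
      linarith
    norm_num at h5 h7
    linarith
  set Λ := Real.log (16 * v) with hΛ
  have hv1 : 1 ≤ v := by linarith [Real.add_one_le_exp 64]
  have hΛ0 : 0 < Λ := Real.log_pos (by linarith)
  have hκ : 0 < Λ / Real.log x := by positivity
  have hκ1 : Λ / Real.log x ≤ 1 :=
    (div_le_one hlx).2 (Real.log_le_log (by positivity) hxv)
  have hκx : Λ / Real.log x * Real.log x = Λ := div_mul_cancel₀ _ hlx.ne'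
  have h8 := sum_prime_rpow_sub_one_div_le hκ hκ1 hx (s := P.primeFactors)
    fun p hp => ⟨Nat.prime_of_mem_primeFactors hp, hPx p hp⟩
  rw [hκx] at h8
  have h9 := selberg_tail_exponent_le hv
  rw [← hΛ] at h9
  have h10 := one_sub_le_prod_mul_selbergSum hP hκ.le (show 0 < x ^ v by positivity)
  refine le_trans (sub_le_sub_left ?_ 1) h10
  rw [Real.rpow_def_of_pos (show 0 < 2 * v by positivity)]
  apply Real.exp_le_exp.2
  have h11 : Λ / Real.log x * Real.log (x ^ v) = v * Λ := by
    rw [Real.log_rpow hx0]; field_simp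
  -- The constant 16 = 2 · 4^(3/2) is chosen so that the prime sum, at most (3/2) v log 4, cancels
  -- in the exponent -vΛ and leaves exactly -v log(2v).
  have h12 : Λ = 3 / 2 * Real.log 4 + Real.log (2 * v) := by
    rw [hΛ, show 16 * v = 2 ^ 3 * (2 * v) by ring, Real.log_mul (by norm_num) (by positivity),
      Real.log_pow, hlog42]
    push_cast; ring
  have h13 := h8.trans (mul_le_mul_of_nonneg_left h9 hl4.le)
  have h14 := congrArg (v * ·) h12
  rw [h11]
  linarith

theorem card_coprime_le_of_large {u x : ℝ} (hu : 2 * Real.exp 64 ≤ u) (hx : 1 < x)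
    {P : ℕ} (hP : Squarefree P) (hPx : ∀ p ∈ P.primeFactors, (p : ℝ) ≤ x)
    {I : Finset ℤ} {Y : ℝ} (hY : 0 ≤ Y)
    (hI : ∀ d : ℕ, 1 ≤ d → |(#{n ∈ I | (d : ℤ) ∣ n} : ℝ) - Y / d| ≤ 1) :
    (#{n ∈ I | n.natAbs.Coprime P} : ℝ) ≤
      Y * (∏ p ∈ P.primeFactors, (1 - (p : ℝ)⁻¹)) * (1 + 2 * u ^ (-u / 2)) + x ^ u := by
  have hx0 : 0 < x := by linarith
  have hu1 : 2 ≤ u := by linarith [Real.add_one_le_exp 64]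
  have hξ : 1 ≤ x ^ (u / 2) := Real.one_le_rpow hx.le (by linarith)
  have h := card_coprime_le_selberg hP hξ hI
  have h1 := one_sub_rpow_le_prod_mul_selbergSum (v := u / 2) (by linarith) hx hP hPx
  have hG := selbergSum_pos hP.ne_zero hξ
  have hV := prod_one_sub_inv_pos P
  rw [show 2 * (u / 2) = u by ring, show -(u / 2) = -u / 2 by ring] at h1
  set τ := u ^ (-u / 2) with hτ
  set V := ∏ p ∈ P.primeFactors, (1 - (p : ℝ)⁻¹)
  set G := selbergSum P (x ^ (u / 2))
  have hτ0 : 0 ≤ τ := by positivity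
  have hτ2 : τ ≤ 1 / 2 := by
    have e1 : τ ≤ u ^ (-1 : ℝ) := Real.rpow_le_rpow_of_exponent_le (by linarith) (by linarith)
    have e2 : u ^ (-1 : ℝ) ≤ 2 ^ (-1 : ℝ) :=
      Real.rpow_le_rpow_of_nonpos (by norm_num) hu1 (by norm_num)
    rw [Real.rpow_neg_one 2] at e2
    linarith
  have h2 : Y / G ≤ Y * V * (1 + 2 * τ) := by
    rw [div_le_iff₀ hG]
    have : 1 ≤ (1 + 2 * τ) * (V * G) := by nlinarith
    nlinarith
  have h3 : (x ^ (u / 2)) ^ 2 = x ^ u := by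
    rw [← Real.rpow_natCast, ← Real.rpow_mul hx0.le]; congr 1; push_cast; ring
  linarith

/-- Fundamental lemma of the sieve (upper bound, dimension one). -/
theorem exists_card_coprime_le :
    ∃ K : ℝ, 0 < K ∧ ∀ u T : ℝ, 1 ≤ u → 2 ≤ T → ∀ P : ℕ, Squarefree P →
      (∀ p ∈ P.primeFactors, (p : ℝ) ≤ T) → ∀ (I : Finset ℤ) (Y : ℝ), 0 ≤ Y →
      (∀ d : ℕ, 1 ≤ d → |(#{n ∈ I | (d : ℤ) ∣ n} : ℝ) - Y / d| ≤ 1) →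
      (#{n ∈ I | n.natAbs.Coprime P} : ℝ) ≤
        Y * (∏ p ∈ P.primeFactors, (1 - (p : ℝ)⁻¹)) * (1 + K * u ^ (-u / 2)) + T ^ u := by
  set w : ℝ := 2 * Real.exp 64 with hw
  have hw1 : 1 ≤ w := by linarith [Real.add_one_le_exp 64]
  have hw0 : 0 < w := by linarith
  set M : ℝ := Real.exp (2 * (Real.log 4 * (w * (1 / Real.log 2 + 1)))) with hM
  have hl4 : 0 < Real.log 4 := Real.log_pos (by norm_num)
  have hl2 : 0 < Real.log 2 := Real.log_pos (by norm_num)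
  have hM0 : 0 < M := Real.exp_pos _
  refine ⟨2 + 3 * M * w ^ (w / 2), by positivity, fun u T hu hT P hP hPT I Y hY hI => ?_⟩
  have hT0 : 0 < T := by linarith
  have hT1 : 1 < T := by linarith
  have hu0 : 0 < u := by linarith
  have hV := prod_one_sub_inv_pos P
  have hlT : Real.log 2 ≤ Real.log T := Real.log_le_log (by norm_num) hT
  have hlT0 : 0 < Real.log T := by linarith
  rcases le_or_gt w u with huw | huw
  · refine (card_coprime_le_of_large huw hT1 hP hPT hY hI).trans ?_
    gcongr
    linarith [show 0 ≤ 3 * M * w ^ (w / 2) by positivity]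
  -- For u below the constant w, sieve only by primes up to x = T^(u/w), so that x^w = T^u. Mertens
  -- bounds the loss from the dropped primes by the constant M, and u^(-u/2) ≥ w^(-w/2) lets K
  -- absorb it.
  set x := T ^ (u / w) with hx
  have hx1 : 1 < x := Real.one_lt_rpow hT1 (by positivity)
  set s := P.primeFactors.filter (fun p : ℕ => (p : ℝ) ≤ x) with hs
  set Q := ∏ p ∈ s, p with hQ
  have hsP : s ⊆ P.primeFactors := Finset.filter_subset _ _
  have hQP : Q ∣ P := by
    rw [← Nat.prod_primeFactors_of_squarefree hP]
    exact Finset.prod_dvd_prod_of_subset _ _ _ hsP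
  have hQsq := hP.squarefree_of_dvd hQP
  have hQs : Q.primeFactors = s :=
    Nat.primeFactors_prod fun p hp => Nat.prime_of_mem_primeFactors (hsP hp)
  have h1 := card_coprime_le_of_large le_rfl hx1 hQsq
    (by rw [hQs]; exact fun p hp => (Finset.mem_filter.1 hp).2) hY hI
  have h2 : (#{n ∈ I | n.natAbs.Coprime P} : ℝ) ≤ #{n ∈ I | n.natAbs.Coprime Q} := by
    refine Nat.cast_le.2 (Finset.card_le_card ?_)
    exact Finset.monotone_filter_right I fun n _ hn => hn.coprime_dvd_right hQP
  rw [← hw, hQs] at h1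
  have hxw : x ^ w = T ^ u := by
    rw [hx, ← Real.rpow_mul hT0.le]; congr 1; field_simp
  have hwτ : w ^ (-w / 2) ≤ 1 :=
    Real.rpow_le_one_of_one_le_of_nonpos hw1 (by linarith)
  have hVs : ∏ p ∈ s, (1 - (p : ℝ)⁻¹) ≤ (∏ p ∈ P.primeFactors, (1 - (p : ℝ)⁻¹)) * M := by
    have h3 := prod_prime_Ioc_one_sub_inv_le (x := T) (y := x) hT1.le hx1
      (s := P.primeFactors.filter (fun p : ℕ => ¬ (p : ℝ) ≤ x)) (fun p hp => by
        obtain ⟨hp1, hp2⟩ := Finset.mem_filter.1 hp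
        exact ⟨Nat.prime_of_mem_primeFactors hp1, hPT p hp1, (not_le.1 hp2).le⟩)
    have h4 : Real.exp (2 * (Real.log 4 * (1 + Real.log T) / Real.log x)) ≤ M := by
      apply Real.exp_le_exp.2
      rw [mul_div_assoc]
      gcongr
      rw [hx, Real.log_rpow hT0, div_le_iff₀ (by positivity)]
      have e : w * (1 / Real.log 2 + 1) * (u / w * Real.log T) =
          u * (Real.log T / Real.log 2 + Real.log T) := by field_simp
      rw [e]
      have : 1 ≤ Real.log T / Real.log 2 := (one_le_div hl2).2 hlT
      nlinarith
    rw [← Finset.prod_filter_mul_prod_filter_not P.primeFactors (fun p : ℕ => (p : ℝ) ≤ x), ← hs,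
      mul_assoc]
    refine le_mul_of_one_le_right (Finset.prod_nonneg fun p hp =>
      (one_sub_prime_inv_pos (Nat.prime_of_mem_primeFactors (hsP hp))).le) ?_
    rw [Finset.prod_inv_distrib] at h3
    have h5 : 0 < ∏ p ∈ P.primeFactors with ¬ ((p : ℕ) : ℝ) ≤ x, (1 - (p : ℝ)⁻¹) :=
      Finset.prod_pos fun p hp =>
        one_sub_prime_inv_pos (Nat.prime_of_mem_primeFactors (Finset.mem_filter.1 hp).1)
    have h6 := h3.trans h4
    rwa [inv_le_iff_one_le_mul₀ h5, mul_comm] at h6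
  have huτ : 1 ≤ w ^ (w / 2) * u ^ (-u / 2) := by
    have e1 : u ^ (u / 2) ≤ w ^ (w / 2) :=
      (Real.rpow_le_rpow hu0.le huw.le (by positivity)).trans
        (Real.rpow_le_rpow_of_exponent_le hw1 (by linarith))
    have e2 : u ^ (u / 2) * u ^ (-u / 2) = 1 := by
      rw [← Real.rpow_add hu0]; simp [neg_div]
    calc 1 = u ^ (u / 2) * u ^ (-u / 2) := e2.symm
      _ ≤ _ := by gcongr
  refine h2.trans (h1.trans ?_)
  rw [hxw]
  gcongr ?_ + _
  set V := ∏ p ∈ P.primeFactors, (1 - (p : ℝ)⁻¹)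
  calc Y * (∏ p ∈ s, (1 - (p : ℝ)⁻¹)) * (1 + 2 * w ^ (-w / 2)) ≤ Y * (V * M) * 3 := by
        gcongr; linarith
    _ = Y * V * (3 * M * 1) := by ring
    _ ≤ Y * V * (3 * M * (w ^ (w / 2) * u ^ (-u / 2))) := by gcongr
    _ ≤ _ := by
      gcongr
      nlinarith [show 0 ≤ u ^ (-u / 2) by positivity]

/-! ### Pairs of reduced fractions with a given difference -/

/-- Chinese remainder theorem, as an upper bound for the number of `j < g` whose residues modulo
the primes of `s` lie in prescribed sets. -/
theorem card_range_residues_le {g : ℕ} {s : Finset ℕ} (hs : ∀ p ∈ s, p.Prime)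
    (hsg : ∏ p ∈ s, p ∣ g) (R : ∀ p : ℕ, Finset (ZMod p)) :
    #{j ∈ range g | ∀ p ∈ s, ((j : ℕ) : ZMod p) ∈ R p} ≤
      g / (∏ p ∈ s, p) * ∏ p ∈ s, #(R p) := by
  set n := ∏ p ∈ s, p with hn
  have hn0 : 0 < n := Finset.prod_pos fun p hp => (hs p hp).pos
  rw [← Finset.card_pi s R]
  refine Finset.card_le_mul_card_image_of_maps_to
    (f := fun j : ℕ => fun (p : ℕ) (_ : p ∈ s) => (j : ZMod p)) ?_ _ ?_
  · intro j hj
    exact Finset.mem_pi.2 fun p hp => (Finset.mem_filter.1 hj).2 p hp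
  · intro x _
    rcases Finset.eq_empty_or_nonempty
      ({j ∈ ({j ∈ range g | ∀ p ∈ s, ((j : ℕ) : ZMod p) ∈ R p}) |
        (fun (p : ℕ) (_ : p ∈ s) => ((j : ℕ) : ZMod p)) = x}) with h | ⟨j₀, hj₀⟩
    · rw [h]; simp
    · have hsub : {j ∈ ({j ∈ range g | ∀ p ∈ s, ((j : ℕ) : ZMod p) ∈ R p}) |
          (fun (p : ℕ) (_ : p ∈ s) => ((j : ℕ) : ZMod p)) = x} ⊆
          {j ∈ range g | j ≡ j₀ [MOD n]} := by
        intro j hj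
        simp only [mem_filter] at hj hj₀ ⊢
        refine ⟨hj.1.1, ?_⟩
        rw [Nat.modEq_iff_dvd, Int.natCast_dvd]
        refine Finset.prod_primes_dvd _ (fun p hp => (hs p hp).prime) fun p hp => ?_
        rw [← Int.natCast_dvd, ← Nat.modEq_iff_dvd, ← ZMod.natCast_eq_natCast_iff]
        exact congrFun (congrFun (hj.2.trans hj₀.2.symm) p) hp
      refine (Finset.card_le_card hsub).trans ?_
      rw [← Nat.count_eq_card_filter_range, Nat.count_modEq_card _ hn0, Nat.mod_eq_zero_of_dvd hsg]
      simp

/-- The number of residues avoiding two (possibly coincident or degenerate) linear conditions. -/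
theorem card_zmod_linear_ne_zero_le {p : ℕ} [Fact p.Prime] (a b k l : ZMod p)
    (hkl : k ≠ 0 ∨ l ≠ 0) :
    #{τ : ZMod p | a + k * τ ≠ 0 ∧ b + l * τ ≠ 0} ≤ p - 1 := by
  classical
  have key : ∀ c d : ZMod p, d ≠ 0 → #{τ : ZMod p | c + d * τ ≠ 0} ≤ p - 1 := by
    intro c d hd
    have hsub : ({τ : ZMod p | c + d * τ ≠ 0} : Finset (ZMod p)) ⊆
        Finset.univ.erase (-c / d) := by
      intro τ hτ
      simp only [mem_filter, mem_univ, true_and, mem_erase, and_true] at hτ ⊢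
      rintro rfl
      exact hτ (by field_simp; ring)
    refine (Finset.card_le_card hsub).trans (le_of_eq ?_)
    rw [Finset.card_erase_of_mem (mem_univ _), Finset.card_univ, ZMod.card]
  rcases hkl with h | h
  · exact (Finset.card_le_card (Finset.monotone_filter_right _ fun τ _ hτ => hτ.1)).trans (key a k h)
  · exact (Finset.card_le_card (Finset.monotone_filter_right _ fun τ _ hτ => hτ.2)).trans (key b l h)

/-- The nonzero determinant makes the two excluded roots -a/k and -b/l distinct. -/
theorem card_zmod_linear_ne_zero_le_sub_two {p : ℕ} [Fact p.Prime] (a b k l : ZMod p)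
    (hk : k ≠ 0) (hl : l ≠ 0) (hne : a * l - b * k ≠ 0) :
    #{τ : ZMod p | a + k * τ ≠ 0 ∧ b + l * τ ≠ 0} ≤ p - 2 := by
  classical
  have hsub : ({τ : ZMod p | a + k * τ ≠ 0 ∧ b + l * τ ≠ 0} : Finset (ZMod p)) ⊆
      (Finset.univ.erase (-a / k)).erase (-b / l) := by
    intro τ hτ
    simp only [mem_filter, mem_univ, true_and, mem_erase, and_true] at hτ ⊢
    constructor
    · rintro rfl
      exact hτ.2 (by field_simp; ring)
    · rintro rfl
      exact hτ.1 (by field_simp; ring)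
  refine (Finset.card_le_card hsub).trans (le_of_eq ?_)
  have hmem : -b / l ∈ (Finset.univ : Finset (ZMod p)).erase (-a / k) := by
    simp only [mem_erase, mem_univ, and_true]
    intro h
    rw [div_eq_div_iff hl hk] at h
    exact hne (by linear_combination h)
  rw [Finset.card_erase_of_mem hmem, Finset.card_erase_of_mem (mem_univ _), Finset.card_univ,
    ZMod.card]
  omega

/-- The number of pairs of reduced fractions `a / (g k)`, `b / (g l)` in `(0, 1]` whose difference
is `m / (g k l)`. -/
theorem card_pairs_diff_eq_le {g k l : ℕ} (hg : 0 < g) (hk : 0 < k) (hl : 0 < l)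
    (hkl : k.Coprime l) (m : ℤ) :
    #{x ∈ Icc 1 (g * k) ×ˢ Icc 1 (g * l) | x.1.Coprime (g * k) ∧ x.2.Coprime (g * l) ∧
      (x.1 * l - x.2 * k : ℤ) = m} ≤
    g / (∏ p ∈ g.primeFactors, p) * ∏ p ∈ g.primeFactors,
      (if ¬ p ∣ k * l ∧ ¬ (p : ℤ) ∣ m then p - 2 else p - 1) := by
  set A := {x ∈ Icc 1 (g * k) ×ˢ Icc 1 (g * l) | x.1.Coprime (g * k) ∧ x.2.Coprime (g * l) ∧
      (x.1 * l - x.2 * k : ℤ) = m} with hA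
  rcases A.eq_empty_or_nonempty with h | ⟨⟨a₀, b₀⟩, h₀⟩
  · rw [h]; simp
  have hmem : ∀ x ∈ A, (1 ≤ x.1 ∧ x.1 ≤ g * k) ∧ (1 ≤ x.2 ∧ x.2 ≤ g * l) ∧
      x.1.Coprime (g * k) ∧ x.2.Coprime (g * l) ∧ (x.1 * l - x.2 * k : ℤ) = m := by
    intro x hx
    simpa only [hA, mem_filter, mem_product, mem_Icc, and_assoc] using hx
  have hm0 := (hmem _ h₀).2.2.2.2
  simp only at hm0
  have hk' : (k : ℤ) ≠ 0 := by exact_mod_cast hk.ne'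
  have hl' : (l : ℤ) ≠ 0 := by exact_mod_cast hl.ne'
  have hg' : (0 : ℤ) < g := by exact_mod_cast hg
  -- Two pairs with the same difference satisfy (x.1 - a₀) l = (x.2 - b₀) k, and k, l are coprime;
  -- so all pairs lie on one progression through the base pair.
  have hparam : ∀ x ∈ A, ∃ t : ℤ, (x.1 : ℤ) = a₀ + k * t ∧ (x.2 : ℤ) = b₀ + l * t := by
    intro x hx
    have h1 := (hmem x hx).2.2.2.2
    have h2 : ((x.1 : ℤ) - a₀) * l = (x.2 - b₀) * k := by linear_combination h1 - hm0
    have h3 : (k : ℤ) ∣ (x.1 : ℤ) - a₀ :=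
      (Nat.isCoprime_iff_coprime.2 hkl).dvd_of_dvd_mul_right ⟨x.2 - b₀, by rw [h2]; ring⟩
    obtain ⟨t, ht⟩ := h3
    refine ⟨t, by linarith, ?_⟩
    have : (k : ℤ) * (x.2 - b₀) = k * (l * t) := by rw [ht] at h2; linear_combination -h2
    have := mul_left_cancel₀ hk' this
    linarith
  choose! t ht1 ht2 using hparam
  let R : ∀ p : ℕ, Finset (ZMod p) := fun p => by
    classical
    exact if hp : p.Prime then
      have : Fact p.Prime := ⟨hp⟩
      ({τ : ZMod p | (a₀ : ZMod p) + k * τ ≠ 0 ∧ (b₀ : ZMod p) + l * τ ≠ 0} : Finset (ZMod p))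
    else ∅
  have hmaps : ∀ x ∈ A, (t x % g).toNat ∈
      {j ∈ range g | ∀ p ∈ g.primeFactors, ((j : ℕ) : ZMod p) ∈ R p} := by
    intro x hx
    have hnn := Int.emod_nonneg (t x) hg'.ne'
    simp only [mem_filter, mem_range]
    refine ⟨by have := Int.emod_lt_of_pos (t x) hg'; omega, fun p hp => ?_⟩
    have hpp := Nat.prime_of_mem_primeFactors hp
    have hpg := Nat.dvd_of_mem_primeFactors hp
    have : Fact p.Prime := ⟨hpp⟩
    have hcast : (((t x % g).toNat : ℕ) : ZMod p) = ((t x : ℤ) : ZMod p) := by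
      rw [← Int.cast_natCast, Int.toNat_of_nonneg hnn, ZMod.intCast_eq_intCast_iff]
      exact (Int.mod_modEq (t x) g).of_dvd (by exact_mod_cast hpg)
    rw [hcast]
    simp only [R, dif_pos hpp, mem_filter, mem_univ, true_and]
    have e1 : (a₀ : ZMod p) + k * ((t x : ℤ) : ZMod p) = (x.1 : ZMod p) := by
      have := congrArg (Int.cast : ℤ → ZMod p) (ht1 x hx); push_cast at this; exact this.symm
    have e2 : (b₀ : ZMod p) + l * ((t x : ℤ) : ZMod p) = (x.2 : ZMod p) := by
      have := congrArg (Int.cast : ℤ → ZMod p) (ht2 x hx); push_cast at this; exact this.symm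
    obtain ⟨-, -, hc1, hc2, -⟩ := hmem x hx
    rw [e1, e2]
    constructor
    · rw [Ne, ZMod.natCast_eq_zero_iff]
      exact fun h => Nat.not_coprime_of_dvd_of_dvd hpp.one_lt h (hpg.mul_right k) hc1
    · rw [Ne, ZMod.natCast_eq_zero_iff]
      exact fun h => Nat.not_coprime_of_dvd_of_dvd hpp.one_lt h (hpg.mul_right l) hc2
  -- Congruent parameters t make the first coordinates differ by a multiple of gk; both lie in [1,
  -- gk], so they agree.
  have hinj : Set.InjOn (fun x => (t x % g).toNat) A := by
    intro x hx y hy hxy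
    have h1 : t x % g = t y % g := by
      have := Int.emod_nonneg (t x) hg'.ne'
      have := Int.emod_nonneg (t y) hg'.ne'
      simp only at hxy
      omega
    obtain ⟨c, hc⟩ : (g : ℤ) ∣ t y - t x := Int.ModEq.dvd h1
    obtain ⟨⟨hx1, hx2⟩, -⟩ := hmem x hx
    obtain ⟨⟨hy1, hy2⟩, -⟩ := hmem y hy
    have h2 : (y.1 : ℤ) - x.1 = g * k * c := by
      rw [ht1 x hx, ht1 y hy]; linear_combination (k : ℤ) * hc
    have hgk : (0 : ℤ) < g * k := by positivity
    have hc0 : c = 0 := by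
      have b1 : (y.1 : ℤ) - x.1 < g * k := by
        have : (y.1 : ℤ) ≤ g * k := by exact_mod_cast hy2
        omega
      have b2 : -(g * k : ℤ) < (y.1 : ℤ) - x.1 := by
        have : (x.1 : ℤ) ≤ g * k := by exact_mod_cast hx2
        omega
      rw [h2] at b1 b2
      have : c < 1 := by nlinarith
      have : -1 < c := by nlinarith
      omega
    have h3 : t x = t y := by rw [hc0] at hc; linarith
    have e1 : (x.1 : ℤ) = y.1 := by rw [ht1 x hx, ht1 y hy, h3]
    have e2 : (x.2 : ℤ) = y.2 := by rw [ht2 x hx, ht2 y hy, h3]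
    exact Prod.ext (by exact_mod_cast e1) (by exact_mod_cast e2)
  refine (Finset.card_le_card_of_injOn _ hmaps hinj).trans ((card_range_residues_le
    (fun p hp => Nat.prime_of_mem_primeFactors hp) (Nat.prod_primeFactors_dvd g) R).trans ?_)
  refine Nat.mul_le_mul_left _ (Finset.prod_le_prod' fun p hp => ?_)
  have hpp := Nat.prime_of_mem_primeFactors hp
  have : Fact p.Prime := ⟨hpp⟩
  have hkl0 : (k : ZMod p) ≠ 0 ∨ (l : ZMod p) ≠ 0 := by
    by_contra! hcon
    rw [ZMod.natCast_eq_zero_iff, ZMod.natCast_eq_zero_iff] at hcon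
    exact Nat.not_coprime_of_dvd_of_dvd hpp.one_lt hcon.1 hcon.2 hkl
  simp only [R, dif_pos hpp]
  split_ifs with hcond
  · refine card_zmod_linear_ne_zero_le_sub_two _ _ _ _ ?_ ?_ ?_
    · rw [Ne, ZMod.natCast_eq_zero_iff]; exact fun h => hcond.1 (h.mul_right l)
    · rw [Ne, ZMod.natCast_eq_zero_iff]; exact fun h => hcond.1 (h.mul_left k)
    · have : (a₀ : ZMod p) * l - b₀ * k = (m : ZMod p) := by
        rw [← hm0]; push_cast; ring
      rw [this, Ne, ZMod.intCast_zmod_eq_zero_iff_dvd]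
      exact hcond.2
  · exact card_zmod_linear_ne_zero_le _ _ _ _ hkl0

/-- Modulo k the difference is al, a product of units, and modulo l it is -bk. Hence the differences
may be sieved by the primes of kl. -/
theorem coprime_of_pairs_diff {g k l a b : ℕ} (hkl : k.Coprime l)
    (ha : a.Coprime (g * k)) (hb : b.Coprime (g * l)) :
    (a * l - b * k : ℤ).natAbs.Coprime (k * l) := by
  have hak : IsCoprime (a : ℤ) k := Nat.isCoprime_iff_coprime.2 (Nat.Coprime.coprime_mul_left_right ha)
  have hbl : IsCoprime (b : ℤ) l := Nat.isCoprime_iff_coprime.2 (Nat.Coprime.coprime_mul_left_right hb)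
  have hkl' : IsCoprime (k : ℤ) l := Nat.isCoprime_iff_coprime.2 hkl
  have h1 : IsCoprime (a * l - b * k : ℤ) k := by
    rw [show (a * l - b * k : ℤ) = a * l + k * -(b : ℤ) by ring]
    exact (hak.mul_left hkl'.symm).add_mul_left_left (-(b : ℤ))
  have h2 : IsCoprime (a * l - b * k : ℤ) l := by
    rw [show (a * l - b * k : ℤ) = -(b * k) + l * a by ring]
    exact (hbl.mul_left hkl').neg_left.add_mul_left_left (a : ℤ)
  rw [Nat.coprime_mul_iff_right]
  rw [Int.isCoprime_iff_gcd_eq_one] at h1 h2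
  exact ⟨by simpa [Int.gcd] using h1, by simpa [Int.gcd] using h2⟩

/-! ### Expansion over divisors and the sifted count -/

/-- The primes dividing `g` but not `n`. -/
def primesOff (g n : ℕ) : Finset ℕ := {p ∈ g.primeFactors | ¬ p ∣ n}

/-- The coefficients in the expansion of the local densities over the divisors `∏ s`. -/
noncomputable def divisorCoeff (G s : Finset ℕ) : ℝ :=
  (∏ p ∈ s, ((p : ℝ) - 1)⁻¹) * ∏ p ∈ G \ s, (((p : ℝ) - 2) / ((p : ℝ) - 1))

/-- At each p ∣ g with p ∤ kl the local factor is 1 or (p-2)/(p-1) according as p ∣ m or not, that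
is, 1_{p ∣ m}/(p-1) + (p-2)/(p-1). Multiplying out gives a sum over subsets s, whose terms test
divisibility of m by ∏ s. -/
theorem card_pairs_diff_eq_le_sum {g k l : ℕ} (hg : 0 < g) (hk : 0 < k) (hl : 0 < l)
    (hkl : k.Coprime l) (m : ℤ) :
    (#{x ∈ Icc 1 (g * k) ×ˢ Icc 1 (g * l) | x.1.Coprime (g * k) ∧ x.2.Coprime (g * l) ∧
      (x.1 * l - x.2 * k : ℤ) = m} : ℝ) ≤
    g.totient * ∑ s ∈ (primesOff g (k * l)).powerset, divisorCoeff (primesOff g (k * l)) s *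
      (if m.natAbs.Coprime (k * l) ∧ ((∏ p ∈ s, p : ℕ) : ℤ) ∣ m then 1 else 0) := by
  by_cases hm : m.natAbs.Coprime (k * l)
  swap
  · rw [Finset.filter_false_of_mem]
    · simp [hm]
    · rintro x - ⟨h1, h2, rfl⟩
      exact hm (coprime_of_pairs_diff hkl h1 h2)
  refine (Nat.cast_le.2 (card_pairs_diff_eq_le hg hk hl hkl m)).trans (le_of_eq ?_)
  have hprod : ∑ s ∈ (primesOff g (k * l)).powerset, divisorCoeff (primesOff g (k * l)) s *
      (if m.natAbs.Coprime (k * l) ∧ ((∏ p ∈ s, p : ℕ) : ℤ) ∣ m then 1 else 0) =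
      ∏ p ∈ primesOff g (k * l), (((p : ℝ) - 1)⁻¹ * (if (p : ℤ) ∣ m then 1 else 0) +
        ((p : ℝ) - 2) / ((p : ℝ) - 1)) := by
    rw [Finset.prod_add]
    refine Finset.sum_congr rfl fun s hs => ?_
    have hsp : ∀ p ∈ s, p.Prime := fun p hp =>
      Nat.prime_of_mem_primeFactors (Finset.mem_filter.1 (Finset.mem_powerset.1 hs hp)).1
    have hiff : ((∏ p ∈ s, p : ℕ) : ℤ) ∣ m ↔ ∀ p ∈ s, (p : ℤ) ∣ m := by
      simp only [Int.natCast_dvd]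
      exact ⟨fun h p hp => (Finset.dvd_prod_of_mem _ hp).trans h, fun h =>
        Finset.prod_primes_dvd _ (fun p hp => (hsp p hp).prime) h⟩
    rw [divisorCoeff, Finset.prod_mul_distrib, Finset.prod_ite_zero]
    by_cases h : ∀ p ∈ s, (p : ℤ) ∣ m
    · rw [if_pos ⟨hm, hiff.2 h⟩, if_pos h, prod_const_one]
      ring
    · rw [if_neg fun hc => h (hiff.1 hc.2), if_neg h]
      ring
  rw [hprod, Nat.totient_eq_div_primeFactors_mul]
  push_cast
  rw [mul_assoc]
  congr 1
  rw [primesOff, Finset.prod_filter, ← Finset.prod_mul_distrib]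
  refine Finset.prod_congr rfl fun p hp => ?_
  have hpp := Nat.prime_of_mem_primeFactors hp
  have h1 : (1 : ℝ) < p := by exact_mod_cast hpp.one_lt
  have h2 : (p : ℝ) - 1 ≠ 0 := by linarith
  have e1 : ((p - 1 : ℕ) : ℝ) = p - 1 := by rw [Nat.cast_sub hpp.one_lt.le]; simp
  have e2 : ((p - 2 : ℕ) : ℝ) = p - 2 := by rw [Nat.cast_sub hpp.two_le]; simp
  by_cases hd : p ∣ k * l
  · simp [hd, e1]
  · by_cases hdm : (p : ℤ) ∣ m
    · simp only [hd, hdm, not_false_eq_true, not_true_eq_false, and_false, if_false, if_true, e1]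
      field_simp
      ring
    · simp only [hd, hdm, not_false_eq_true, and_self, if_false, if_true, e1, e2]
      field_simp
      ring

/-- The number of pairs of reduced fractions with difference in a prescribed set, bounded by
weighted counts of sifted multiples. -/
theorem card_pairs_le {g k l : ℕ} (hg : 0 < g) (hk : 0 < k) (hl : 0 < l)
    (hkl : k.Coprime l) (I : Finset ℤ) :
    (#{x ∈ Icc 1 (g * k) ×ˢ Icc 1 (g * l) | x.1.Coprime (g * k) ∧ x.2.Coprime (g * l) ∧
      (x.1 * l - x.2 * k : ℤ) ∈ I} : ℝ) ≤
    g.totient * ∑ s ∈ (primesOff g (k * l)).powerset, divisorCoeff (primesOff g (k * l)) s *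
      #{m ∈ I | m.natAbs.Coprime (k * l) ∧ ((∏ p ∈ s, p : ℕ) : ℤ) ∣ m} := by
  have h1 : #{x ∈ Icc 1 (g * k) ×ˢ Icc 1 (g * l) | x.1.Coprime (g * k) ∧ x.2.Coprime (g * l) ∧
      (x.1 * l - x.2 * k : ℤ) ∈ I} =
      ∑ m ∈ I, #{x ∈ Icc 1 (g * k) ×ˢ Icc 1 (g * l) | x.1.Coprime (g * k) ∧
        x.2.Coprime (g * l) ∧ (x.1 * l - x.2 * k : ℤ) = m} := by
    rw [Finset.card_eq_sum_card_fiberwise (f := fun x : ℕ × ℕ => (x.1 * l - x.2 * k : ℤ)) (t := I)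
      fun x hx => (Finset.mem_filter.1 hx).2.2.2]
    refine Finset.sum_congr rfl fun m hm => ?_
    rw [Finset.filter_filter]
    congr 1
    refine Finset.filter_congr fun x _ => ?_
    constructor
    · rintro ⟨⟨h1, h2, -⟩, h3⟩; exact ⟨h1, h2, h3⟩
    · rintro ⟨h1, h2, h3⟩; exact ⟨⟨h1, h2, h3 ▸ hm⟩, h3⟩
  rw [h1]
  push_cast
  refine (Finset.sum_le_sum fun m _ => card_pairs_diff_eq_le_sum hg hk hl hkl m).trans
    (le_of_eq ?_)
  rw [← Finset.mul_sum, Finset.sum_comm]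
  congr 1
  refine Finset.sum_congr rfl fun s _ => ?_
  rw [← Finset.mul_sum, Finset.card_filter]
  push_cast
  rfl

/-- The integers in the open real interval `(α, β)`. -/
noncomputable def intsIoo (α β : ℝ) : Finset ℤ := Finset.Ioo ⌊α⌋ ⌈β⌉

theorem mem_intsIoo {α β : ℝ} {n : ℤ} : n ∈ intsIoo α β ↔ α < n ∧ (n : ℝ) < β := by
  simp [intsIoo, Int.floor_lt, Int.lt_ceil]

theorem abs_card_intsIoo_sub_le {α β : ℝ} (h : α ≤ β) :
    |(#(intsIoo α β) : ℝ) - (β - α)| ≤ 1 := by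
  -- The truncation at 0 matters only when α = β is an integer: then ⌈β⌉ - ⌊α⌋ - 1 = -1.
  have hc : (#(intsIoo α β) : ℤ) = max (⌈β⌉ - ⌊α⌋ - 1) 0 := by
    rw [intsIoo, Int.card_Ioo, Int.toNat_eq_max]
  have hc' : (#(intsIoo α β) : ℝ) = max ((⌈β⌉ : ℝ) - ⌊α⌋ - 1) 0 := by exact_mod_cast hc
  rw [hc', abs_le]
  have h1 := Int.ceil_lt_add_one β
  have h2 := Int.le_ceil β
  have h3 := Int.floor_le α
  have h4 := Int.lt_floor_add_one α
  constructor
  · have := le_max_left ((⌈β⌉ : ℝ) - ⌊α⌋ - 1) 0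
    linarith
  · have : max ((⌈β⌉ : ℝ) - ⌊α⌋ - 1) 0 ≤ β - α + 1 := max_le (by linarith) (by linarith)
    linarith

theorem card_intsIoo_filter_dvd {α β : ℝ} {e : ℕ} (he : 1 ≤ e) :
    #{n ∈ intsIoo α β | (e : ℤ) ∣ n} = #(intsIoo (α / e) (β / e)) := by
  have he0 : (0 : ℝ) < e := by exact_mod_cast he
  have himg : {n ∈ intsIoo α β | (e : ℤ) ∣ n} = (intsIoo (α / e) (β / e)).image ((e : ℤ) * ·) := by
    ext n
    simp only [mem_filter, mem_intsIoo, mem_image]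
    constructor
    · rintro ⟨⟨h1, h2⟩, j, rfl⟩
      push_cast at h1 h2
      exact ⟨j, ⟨by rw [div_lt_iff₀ he0]; linarith, by rw [lt_div_iff₀ he0]; linarith⟩, rfl⟩
    · rintro ⟨j, ⟨h1, h2⟩, rfl⟩
      rw [div_lt_iff₀ he0] at h1
      rw [lt_div_iff₀ he0] at h2
      push_cast
      exact ⟨⟨by linarith, by linarith⟩, dvd_mul_right _ _⟩
  rw [himg, Finset.card_image_of_injective _ (mul_right_injective₀ (by exact_mod_cast he0.ne'))]

theorem abs_card_intsIoo_filter_dvd_sub_le {α β : ℝ} (h : α ≤ β) {e : ℕ} (he : 1 ≤ e) :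
    |(#{n ∈ intsIoo α β | (e : ℤ) ∣ n} : ℝ) - (β - α) / e| ≤ 1 := by
  rw [card_intsIoo_filter_dvd he, sub_div]
  exact abs_card_intsIoo_sub_le (by gcongr)

theorem divisorCoeff_nonneg {G s : Finset ℕ} (hG : ∀ p ∈ G, p.Prime) (hs : s ⊆ G) :
    0 ≤ divisorCoeff G s := by
  refine mul_nonneg (Finset.prod_nonneg fun p hp => ?_) (Finset.prod_nonneg fun p hp => ?_)
  · have : (2 : ℝ) ≤ p := by exact_mod_cast (hG p (hs hp)).two_le
    exact inv_nonneg.2 (by linarith)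
  · have : (2 : ℝ) ≤ p := by exact_mod_cast (hG p (Finset.mem_sdiff.1 hp).1).two_le
    exact div_nonneg (by linarith) (by linarith)

/-- Locally 1/(p(p-1)) + (p-2)/(p-1) = 1 - 1/p. This identity keeps the main term free of any
constant loss. -/
theorem sum_divisorCoeff_div {G : Finset ℕ} (hG : ∀ p ∈ G, p.Prime) :
    ∑ s ∈ G.powerset, divisorCoeff G s / ((∏ p ∈ s, p : ℕ) : ℝ) =
      ∏ p ∈ G, (1 - (p : ℝ)⁻¹) := by
  have h : ∏ p ∈ G, (1 - (p : ℝ)⁻¹) =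
      ∏ p ∈ G, (((p : ℝ) - 1)⁻¹ * (p : ℝ)⁻¹ + ((p : ℝ) - 2) / ((p : ℝ) - 1)) := by
    refine Finset.prod_congr rfl fun p hp => ?_
    have h1 : (1 : ℝ) < p := by exact_mod_cast (hG p hp).one_lt
    have h2 : (p : ℝ) - 1 ≠ 0 := by linarith
    field_simp
    ring
  rw [h, Finset.prod_add]
  refine Finset.sum_congr rfl fun s _ => ?_
  rw [divisorCoeff, Finset.prod_mul_distrib, Finset.prod_inv_distrib (fun p : ℕ => (p : ℝ))]
  push_cast
  rw [div_eq_mul_inv]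
  ring

/-- A product of primes that is at most x involves only primes p ≤ x. Summed over all subsets of
those, the coefficients contribute 1, and each larger prime contributes (p-2)/(p-1) ≤ 1 - 1/p.
Restoring the factors 1 - 1/p for p ≤ x costs O(log x) by Mertens. -/
theorem exists_sum_divisorCoeff_le :
    ∃ K : ℝ, 0 < K ∧ ∀ (G : Finset ℕ) (x : ℝ), (∀ p ∈ G, p.Prime) → 2 ≤ x →
      ∑ s ∈ G.powerset with ((∏ p ∈ s, p : ℕ) : ℝ) ≤ x, divisorCoeff G s ≤
        K * Real.log x * ∏ p ∈ G, (1 - (p : ℝ)⁻¹) := by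
  obtain ⟨K, hK, hM⟩ := exists_prod_prime_one_sub_inv_le
  refine ⟨K, hK, fun G x hG hx => ?_⟩
  set H := G.filter (fun p : ℕ => (p : ℝ) ≤ x) with hH
  have hHG : H ⊆ G := Finset.filter_subset _ _
  have hsub : G.powerset.filter (fun s => ((∏ p ∈ s, p : ℕ) : ℝ) ≤ x) ⊆ H.powerset := by
    intro s hs
    obtain ⟨h1, h2⟩ := Finset.mem_filter.1 hs
    rw [Finset.mem_powerset] at h1 ⊢
    intro p hp
    refine Finset.mem_filter.2 ⟨h1 hp, le_trans ?_ h2⟩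
    have hpos : 0 < ∏ p ∈ s, p := Finset.prod_pos fun p hp => (hG p (h1 hp)).pos
    exact_mod_cast Nat.le_of_dvd hpos (Finset.dvd_prod_of_mem _ hp)
  have h1 : ∀ s ∈ H.powerset, divisorCoeff G s = divisorCoeff H s *
      ∏ p ∈ G \ H, (((p : ℝ) - 2) / ((p : ℝ) - 1)) := by
    intro s hs
    have hs' := Finset.mem_powerset.1 hs
    have hun : G \ s = (H \ s) ∪ (G \ H) := by
      ext p
      simp only [mem_sdiff, mem_union]
      constructor
      · rintro ⟨a, b⟩
        by_cases hp : p ∈ H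
        · exact Or.inl ⟨hp, b⟩
        · exact Or.inr ⟨a, hp⟩
      · rintro (⟨a, b⟩ | ⟨a, b⟩)
        · exact ⟨hHG a, b⟩
        · exact ⟨a, fun h => b (hs' h)⟩
    have hdisj : Disjoint (H \ s) (G \ H) := by
      rw [Finset.disjoint_left]
      intro p hp hp'
      exact (Finset.mem_sdiff.1 hp').2 (Finset.mem_sdiff.1 hp).1
    rw [divisorCoeff, divisorCoeff, hun, Finset.prod_union hdisj, mul_assoc]
  have h2 : ∑ s ∈ H.powerset, divisorCoeff H s = 1 := by
    simp only [divisorCoeff]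
    rw [← Finset.prod_add]
    refine Finset.prod_eq_one fun p hp => ?_
    have h1 : (1 : ℝ) < p := by exact_mod_cast (hG p (hHG hp)).one_lt
    have h2 : (p : ℝ) - 1 ≠ 0 := by linarith
    field_simp
    ring
  have h3 : ∏ p ∈ G \ H, (((p : ℝ) - 2) / ((p : ℝ) - 1)) ≤ ∏ p ∈ G \ H, (1 - (p : ℝ)⁻¹) := by
    refine Finset.prod_le_prod (fun p hp => ?_) fun p hp => ?_
    · have : (2 : ℝ) ≤ p := by exact_mod_cast (hG p (Finset.mem_sdiff.1 hp).1).two_le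
      exact div_nonneg (by linarith) (by linarith)
    · have h1 : (2 : ℝ) ≤ p := by exact_mod_cast (hG p (Finset.mem_sdiff.1 hp).1).two_le
      have h0 : (0 : ℝ) < p := by linarith
      rw [div_le_iff₀ (by linarith)]
      have h5 : (p : ℝ) * (p : ℝ)⁻¹ = 1 := mul_inv_cancel₀ h0.ne'
      have h6 : 0 < (p : ℝ)⁻¹ := by positivity
      nlinarith
  have h4 := hM x hx H fun p hp => ⟨hG p (hHG hp), (Finset.mem_filter.1 hp).2⟩
  have hpos : ∀ S : Finset ℕ, S ⊆ G → 0 < ∏ p ∈ S, (1 - (p : ℝ)⁻¹) := fun S hS =>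
    Finset.prod_pos fun p hp => one_sub_prime_inv_pos (hG p (hS hp))
  calc _ ≤ ∑ s ∈ H.powerset, divisorCoeff G s :=
        Finset.sum_le_sum_of_subset_of_nonneg hsub fun s hs _ =>
          divisorCoeff_nonneg hG ((Finset.mem_powerset.1 hs).trans hHG)
    _ = ∏ p ∈ G \ H, (((p : ℝ) - 2) / ((p : ℝ) - 1)) := by
        rw [Finset.sum_congr rfl h1, ← Finset.sum_mul, h2, one_mul]
    _ ≤ ∏ p ∈ G \ H, (1 - (p : ℝ)⁻¹) := h3
    _ = (∏ p ∈ H, (1 - (p : ℝ)⁻¹)⁻¹) * ∏ p ∈ G, (1 - (p : ℝ)⁻¹) := by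
        rw [← Finset.prod_sdiff hHG, Finset.prod_inv_distrib]
        field_simp [(hpos H hHG).ne']
    _ ≤ _ := mul_le_mul_of_nonneg_right h4 (hpos G subset_rfl).le

/-- The sieve bound for the number of pairs of reduced fractions with denominators `g k`, `g l`
whose scaled difference lies in an interval of length `2 D` near the origin. -/
theorem exists_card_pairs_near_le :
    ∃ K : ℝ, 0 < K ∧ ∀ g k l : ℕ, 0 < g → 0 < k → 0 < l → k.Coprime l →
      ∀ u T D z : ℝ, 1 ≤ u → 2 ≤ T → 1 / 2 ≤ D → |z| ≤ D →
      ∀ I : Finset ℤ, (∀ m ∈ I, m ≠ 0 ∧ |(m : ℝ) - z| < D) →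
      (#{x ∈ Icc 1 (g * k) ×ˢ Icc 1 (g * l) | x.1.Coprime (g * k) ∧ x.2.Coprime (g * l) ∧
        (x.1 * l - x.2 * k : ℤ) ∈ I} : ℝ) ≤
      g.totient * (2 * D) * (∏ p ∈ primesOff g (k * l), (1 - (p : ℝ)⁻¹)) *
        (∏ p ∈ (k * l).primeFactors with ((p : ℕ) : ℝ) ≤ T, (1 - (p : ℝ)⁻¹)) *
        (1 + K * (u ^ (-u / 2) + T ^ u * Real.log (D + 2) * Real.log T / D)) := by
  obtain ⟨K₁, hK₁, hsieve⟩ := exists_card_coprime_le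
  obtain ⟨K₂, hK₂, hcoeff⟩ := exists_sum_divisorCoeff_le
  obtain ⟨K₃, hK₃, hmert⟩ := exists_prod_prime_one_sub_inv_le
  refine ⟨K₁ + K₂ * K₃, by positivity, ?_⟩
  intro g k l hg hk hl hkl u T D z hu hT hD hz I hI
  set G := primesOff g (k * l) with hG
  have hGp : ∀ p ∈ G, p.Prime := fun p hp =>
    Nat.prime_of_mem_primeFactors (Finset.mem_filter.1 hp).1
  set S := (k * l).primeFactors.filter (fun p : ℕ => (p : ℝ) ≤ T) with hS
  have hSp : ∀ p ∈ S, p.Prime ∧ (p : ℝ) ≤ T := fun p hp =>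
    ⟨Nat.prime_of_mem_primeFactors (Finset.mem_filter.1 hp).1, (Finset.mem_filter.1 hp).2⟩
  set P := ∏ p ∈ S, p with hP
  have hPS : P.primeFactors = S := Nat.primeFactors_prod fun p hp => (hSp p hp).1
  have hPkl : P ∣ k * l := (Finset.prod_dvd_prod_of_subset _ _ _ (Finset.filter_subset _ _)).trans
    (Nat.prod_primeFactors_dvd _)
  have hPsq : Squarefree P := by
    refine Finset.squarefree_prod_of_pairwise_isCoprime ?_ fun p hp => (hSp p hp).1.squarefree
    intro p hp q hq hpq
    exact Nat.coprime_iff_isRelPrime.1 ((Nat.coprime_primes (hSp p hp).1 (hSp q hq).1).2 hpq)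
  set V := ∏ p ∈ S, (1 - (p : ℝ)⁻¹) with hV
  set W := ∏ p ∈ G, (1 - (p : ℝ)⁻¹) with hW
  have hV0 : 0 < V := Finset.prod_pos fun p hp => one_sub_prime_inv_pos (hSp p hp).1
  have hW0 : 0 < W := Finset.prod_pos fun p hp => one_sub_prime_inv_pos (hGp p hp)
  have hD0 : 0 < D := by linarith
  have hT0 : 0 < T := by linarith
  have hlT : 0 < Real.log T := Real.log_pos (by linarith)
  have hlD : 0 < Real.log (D + 2) := Real.log_pos (by linarith)
  have hz' := abs_le.1 hz
  have hterm : ∀ s ∈ G.powerset, divisorCoeff G s *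
      (#{m ∈ I | m.natAbs.Coprime (k * l) ∧ ((∏ p ∈ s, p : ℕ) : ℤ) ∣ m} : ℝ) ≤
      divisorCoeff G s / ((∏ p ∈ s, p : ℕ) : ℝ) * (2 * D * V * (1 + K₁ * u ^ (-u / 2))) +
        if ((∏ p ∈ s, p : ℕ) : ℝ) ≤ 2 * D + 2 then divisorCoeff G s * T ^ u else 0 := by
    intro s hs
    have hc := divisorCoeff_nonneg hGp (Finset.mem_powerset.1 hs)
    set d := ∏ p ∈ s, p with hd
    have hd0 : 0 < d := Finset.prod_pos fun p hp => (hGp p (Finset.mem_powerset.1 hs hp)).pos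
    have hd0' : (0 : ℝ) < d := by exact_mod_cast hd0
    by_cases hdD : (d : ℝ) ≤ 2 * D + 2
    · rw [if_pos hdD]
      have hle : (z - D) / d ≤ (z + D) / d := by gcongr; linarith
      have hlen : (z + D) / d - (z - D) / d = 2 * D / d := by ring
      have h1 := hsieve u T hu hT P hPsq (by rw [hPS]; exact fun p hp => (hSp p hp).2)
        (intsIoo ((z - D) / d) ((z + D) / d)) (2 * D / d) (by positivity)
        (fun e he => by rw [← hlen]; exact abs_card_intsIoo_filter_dvd_sub_le hle he)
      rw [hPS, ← hV] at h1
      have h2 : #{m ∈ I | m.natAbs.Coprime (k * l) ∧ (d : ℤ) ∣ m} ≤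
          #{n ∈ intsIoo ((z - D) / d) ((z + D) / d) | n.natAbs.Coprime P} := by
        -- Dividing by d maps the multiples of d into the interval shrunk by d; the quotients remain
        -- prime to kl, hence to P.
        refine Finset.card_le_card_of_injOn (fun m => m / (d : ℤ)) ?_ ?_
        · intro m hm
          obtain ⟨hmI, hcop, j, rfl⟩ := Finset.mem_filter.1 hm
          have hjd : (d : ℤ) * j / d = j := Int.mul_ediv_cancel_left _ (by exact_mod_cast hd0.ne')
          have h3 := abs_lt.1 (hI _ hmI).2
          push_cast at h3
          simp only [coe_filter, Set.mem_ofPred_eq, hjd, mem_intsIoo]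
          refine ⟨⟨by rw [div_lt_iff₀ hd0']; linarith, by rw [lt_div_iff₀ hd0']; linarith⟩, ?_⟩
          rw [Int.natAbs_mul] at hcop
          exact (hcop.coprime_mul_left).coprime_dvd_right hPkl
        · intro m hm m' hm' h
          obtain ⟨-, -, j, rfl⟩ := Finset.mem_filter.1 hm
          obtain ⟨-, -, j', rfl⟩ := Finset.mem_filter.1 hm'
          have hd1 : (d : ℤ) ≠ 0 := by exact_mod_cast hd0.ne'
          simp only [Int.mul_ediv_cancel_left _ hd1] at h
          rw [h]
      have h3 : (#{m ∈ I | m.natAbs.Coprime (k * l) ∧ (d : ℤ) ∣ m} : ℝ) ≤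
          2 * D / d * V * (1 + K₁ * u ^ (-u / 2)) + T ^ u := (Nat.cast_le.2 h2).trans h1
      calc _ ≤ divisorCoeff G s * (2 * D / d * V * (1 + K₁ * u ^ (-u / 2)) + T ^ u) := by gcongr
        _ = _ := by ring
    · rw [if_neg hdD, Finset.filter_false_of_mem]
      · simp only [card_empty, Nat.cast_zero, mul_zero, add_zero]
        positivity
      -- Here 0 < |m| < 2D, so m has no divisor d > 2D + 2, and such d contribute no error T^u.
      · rintro m hm ⟨-, hdm⟩
        obtain ⟨hm0, hmD⟩ := hI m hm
        have h1 : (d : ℤ) ≤ |m| := Int.le_of_dvd (abs_pos.2 hm0) ((dvd_abs _ _).2 hdm)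
        have h2 : (d : ℝ) ≤ |(m : ℝ)| := by exact_mod_cast h1
        have h3 : |(m : ℝ)| < 2 * D + 2 := by
          have := abs_lt.1 hmD
          rw [abs_lt]; constructor <;> linarith
        linarith
  have hsum : ∑ s ∈ G.powerset, divisorCoeff G s *
      (#{m ∈ I | m.natAbs.Coprime (k * l) ∧ ((∏ p ∈ s, p : ℕ) : ℤ) ∣ m} : ℝ) ≤
      W * (2 * D * V * (1 + K₁ * u ^ (-u / 2))) + K₂ * Real.log (2 * D + 2) * W * T ^ u := by
    refine (Finset.sum_le_sum hterm).trans ?_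
    rw [Finset.sum_add_distrib, ← Finset.sum_mul, sum_divisorCoeff_div hGp, ← Finset.sum_filter,
      ← Finset.sum_mul]
    gcongr
    exact hcoeff G (2 * D + 2) hGp (by linarith)
  have hlog : Real.log (2 * D + 2) ≤ 2 * Real.log (D + 2) := by
    rw [show 2 * Real.log (D + 2) = Real.log ((D + 2) ^ 2) by rw [Real.log_pow]; norm_num]
    exact Real.log_le_log (by linarith) (by nlinarith)
  -- The error term lacks the sieve product V; Mertens restores it at the price of log T.
  have hVT : 1 ≤ V * (K₃ * Real.log T) := by
    have h := hmert T hT S hSp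
    rw [Finset.prod_inv_distrib, ← hV, inv_le_iff_one_le_mul₀ hV0] at h
    linarith
  refine (card_pairs_le hg hk hl hkl I).trans ?_
  rw [← hG]
  have herr : K₂ * Real.log (2 * D + 2) * W * T ^ u ≤
      2 * D * W * V * (K₂ * K₃ * (T ^ u * Real.log (D + 2) * Real.log T / D)) := by
    calc _ ≤ K₂ * (2 * Real.log (D + 2)) * W * T ^ u * 1 := by
          rw [mul_one]; gcongr
      _ ≤ K₂ * (2 * Real.log (D + 2)) * W * T ^ u * (V * (K₃ * Real.log T)) := by gcongr
      _ = _ := by field_simp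
  have hτ : 0 ≤ u ^ (-u / 2) := by positivity
  have hE : 0 ≤ T ^ u * Real.log (D + 2) * Real.log T / D := by positivity
  set E := T ^ u * Real.log (D + 2) * Real.log T / D
  set τ := u ^ (-u / 2)
  calc _ ≤ (g.totient : ℝ) * (W * (2 * D * V * (1 + K₁ * τ)) +
        2 * D * W * V * (K₂ * K₃ * E)) := by
        gcongr
        exact hsum.trans (by gcongr)
    _ = g.totient * (2 * D) * W * V * (1 + (K₁ * τ + K₂ * K₃ * E)) := by ring
    _ ≤ _ := by
        gcongr
        nlinarith [mul_nonneg hK₁.le hE, mul_nonneg (mul_pos hK₂ hK₃).le hτ]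

/-! ### From counting to the measure of the overlap -/

open MeasureTheory in
-- Translate every interval to (-δ, δ) and exchange sum and integral: the integrand at y counts the
-- centres a with c a + y ∈ A.
theorem volume_biUnion_Ioo_inter_le {s : Finset ℕ} (c : ℕ → ℝ) {δ : ℝ} {A : Set ℝ}
    (hA : MeasurableSet A) {N : ℕ}
    (hN : ∀ y ∈ Set.Ioo (-δ) δ, ∀ t ⊆ s, (∀ a ∈ t, c a + y ∈ A) → #t ≤ N) :
    volume ((⋃ a ∈ s, Set.Ioo (c a - δ) (c a + δ)) ∩ A) ≤ N * ENNReal.ofReal (2 * δ) := by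
  classical
  have hmeas : ∀ a, MeasurableSet ((fun y => c a + y) ⁻¹' A) := fun a =>
    hA.preimage (measurable_const_add (c a))
  have h1 : volume ((⋃ a ∈ s, Set.Ioo (c a - δ) (c a + δ)) ∩ A) ≤
      ∑ a ∈ s, volume (Set.Ioo (c a - δ) (c a + δ) ∩ A) := by
    rw [Set.iUnion₂_inter]
    exact measure_biUnion_finset_le s _
  have h2 : ∀ a ∈ s, volume (Set.Ioo (c a - δ) (c a + δ) ∩ A) =
      ∫⁻ y in Set.Ioo (-δ) δ, ((fun y => c a + y) ⁻¹' A).indicator 1 y := by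
    intro a _
    rw [lintegral_indicator_one (hmeas a), Measure.restrict_apply (hmeas a),
      ← measure_preimage_add volume (c a) (Set.Ioo (c a - δ) (c a + δ) ∩ A), Set.preimage_inter,
      Set.inter_comm]
    congr 2
    ext y
    simp only [Set.mem_preimage, Set.mem_Ioo]
    constructor <;> rintro ⟨h, h'⟩ <;> constructor <;> linarith
  refine h1.trans ?_
  rw [Finset.sum_congr rfl h2, ← lintegral_finsetSum s fun a _ =>
    (measurable_one.indicator (hmeas a))]
  calc _ ≤ ∫⁻ _ in Set.Ioo (-δ) δ, (N : ENNReal) := by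
        refine setLIntegral_mono measurable_const fun y hy => ?_
        have e : ∑ a ∈ s, ((fun y => c a + y) ⁻¹' A).indicator (1 : ℝ → ENNReal) y =
            (#{a ∈ s | c a + y ∈ A} : ENNReal) := by
          rw [Finset.card_filter]
          push_cast
          exact Finset.sum_congr rfl fun a _ => by simp [Set.indicator_apply]
        rw [e]
        exact_mod_cast hN y hy _ (Finset.filter_subset _ _) fun a ha => (Finset.mem_filter.1 ha).2
    _ = _ := by
        rw [setLIntegral_const, Real.volume_Ioo]
        congr 2; ring

theorem measurableSet_approxSet (ψ : ℕ → ℝ) (q : ℕ) : MeasurableSet (approxSet ψ q) :=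
  Finset.measurableSet_biUnion _ fun _ _ => measurableSet_Ioo

/-- The intervals are disjoint because ψ(q) ≤ 1/2 and distinct centres are at least 1/q apart. -/
theorem volume_real_approxSet {ψ : ℕ → ℝ} {q : ℕ} (hq : 1 ≤ q) (h0 : 0 ≤ ψ q)
    (h1 : ψ q ≤ 1 / 2) :
    MeasureTheory.volume.real (approxSet ψ q) = 2 * (ψ q / q) * q.totient := by
  have hq0 : (0 : ℝ) < q := by exact_mod_cast hq
  have hcard : #{p ∈ Icc 1 q | p.Coprime q} = q.totient := by
    rw [← Nat.filter_coprime_Ico_eq_totient q 1]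
    congr 1
    ext p
    simp only [mem_filter, mem_Icc, mem_Ico, Nat.coprime_comm (m := p)]
    omega
  rw [approxSet, MeasureTheory.measureReal_biUnion_finset (h := fun p _ => by simp)]
  · have hvol : ∀ p ∈ (Icc 1 q).filter (fun p => p.Coprime q),
        MeasureTheory.volume.real (Set.Ioo ((p : ℝ) / q - ψ q / q) ((p : ℝ) / q + ψ q / q)) =
          2 * (ψ q / q) := by
      intro p _
      rw [Real.volume_real_Ioo_of_le (by have : 0 ≤ ψ q / q := by positivity
                                         linarith)]
      ring
    rw [Finset.sum_congr rfl hvol, Finset.sum_const, hcard, nsmul_eq_mul, mul_comm]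
  · have key : ∀ a b : ℕ, a < b → Disjoint (Set.Ioo ((a : ℝ) / q - ψ q / q) (a / q + ψ q / q))
        (Set.Ioo ((b : ℝ) / q - ψ q / q) (b / q + ψ q / q)) := by
      intro a b hab
      rw [Set.disjoint_left]
      rintro x ⟨-, hx1⟩ ⟨hx2, -⟩
      have h3 : (b : ℝ) / q - ψ q / q < a / q + ψ q / q := hx2.trans hx1
      rw [← sub_div, ← add_div, div_lt_div_iff_of_pos_right hq0] at h3
      have : (a : ℝ) + 1 ≤ b := by exact_mod_cast hab
      linarith
    intro a _ b _ hab
    rcases lt_or_gt_of_ne hab with h | h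
    · exact key a b h
    · exact (key b a h).symm
  · exact fun _ _ => measurableSet_Ioo

/-- The primes of gk and of gl have as intersection the primes of g, because k and l are coprime.
Their union is the disjoint union of the primes of kl and those of g off kl. -/
theorem totient_mul_totient_eq {g k l : ℕ} (hg : 0 < g) (hk : 0 < k) (hl : 0 < l)
    (hkl : k.Coprime l) :
    ((g * k).totient : ℝ) * (g * l).totient =
      g.totient * (g * k * l) * (∏ p ∈ primesOff g (k * l), (1 - (p : ℝ)⁻¹)) *
        ∏ p ∈ (k * l).primeFactors, (1 - (p : ℝ)⁻¹) := by
  have htot : ∀ n : ℕ, (n.totient : ℝ) = n * ∏ p ∈ n.primeFactors, (1 - (p : ℝ)⁻¹) := by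
    intro n
    have := congrArg (Rat.cast : ℚ → ℝ) (Nat.totient_eq_mul_prod_factors n)
    push_cast at this
    exact this
  have hunion : (g * k).primeFactors ∪ (g * l).primeFactors =
      primesOff g (k * l) ∪ (k * l).primeFactors := by
    rw [Nat.primeFactors_mul hg.ne' hk.ne', Nat.primeFactors_mul hg.ne' hl.ne',
      Nat.primeFactors_mul hk.ne' hl.ne']
    ext p
    have : p ∈ g.primeFactors → (p ∣ k * l ↔ p ∈ k.primeFactors ∨ p ∈ l.primeFactors) := by
      intro hp
      have hpp := Nat.prime_of_mem_primeFactors hp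
      simp [hpp.dvd_mul, hpp, hk.ne', hl.ne']
    simp only [primesOff, mem_union, mem_filter]
    tauto
  have hinter : (g * k).primeFactors ∩ (g * l).primeFactors = g.primeFactors := by
    rw [Nat.primeFactors_mul hg.ne' hk.ne', Nat.primeFactors_mul hg.ne' hl.ne']
    have := Finset.disjoint_left.1 hkl.disjoint_primeFactors
    ext p
    simp only [mem_union, mem_inter]
    have := @this p
    tauto
  have hdisj : Disjoint (primesOff g (k * l)) (k * l).primeFactors := by
    rw [Finset.disjoint_left]
    intro p hp hp'
    exact (Finset.mem_filter.1 hp).2 (Nat.dvd_of_mem_primeFactors hp')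
  have h := Finset.prod_union_inter (s₁ := (g * k).primeFactors) (s₂ := (g * l).primeFactors)
    (f := fun p : ℕ => (1 - (p : ℝ)⁻¹))
  rw [hunion, hinter, Finset.prod_union hdisj] at h
  rw [htot (g * k), htot (g * l), htot g]
  push_cast
  linear_combination (-(g * k * (g * l)) : ℝ) * h

/-- The factor 1 + 1/(p-1) is the inverse of 1 - 1/p, so it cancels the primes above T. -/
theorem prod_filter_le_eq_mul_largePrimeProd {g k l : ℕ} (hg : 0 < g) (hkl : k.Coprime l) (T : ℝ) :
    ∏ p ∈ (k * l).primeFactors with ((p : ℕ) : ℝ) ≤ T, (1 - (p : ℝ)⁻¹) =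
      (∏ p ∈ (k * l).primeFactors, (1 - (p : ℝ)⁻¹)) * largePrimeProd (g * k) (g * l) T := by
  have hgcd : (g * k).gcd (g * l) = g := by rw [Nat.gcd_mul_left, hkl.gcd_eq_one, mul_one]
  have hdiv : g * k * (g * l) / (g * k).gcd (g * l) ^ 2 = k * l := by
    rw [hgcd, show g * k * (g * l) = k * l * g ^ 2 by ring]
    exact Nat.mul_div_cancel _ (by positivity)
  rw [largePrimeProd, hdiv, ← Finset.prod_filter_mul_prod_filter_not (k * l).primeFactors
    (fun p : ℕ => (p : ℝ) ≤ T), mul_assoc]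
  simp only [not_le]
  rw [← Finset.prod_mul_distrib]
  refine (mul_one _).symm.trans (congrArg _ (Finset.prod_eq_one ?_).symm)
  intro p hp
  have h1 : (1 : ℝ) < p := by
    exact_mod_cast (Nat.prime_of_mem_primeFactors (Finset.mem_filter.1 hp).1).one_lt
  have h2 : (p : ℝ) - 1 ≠ 0 := by linarith
  field_simp
  ring

theorem largePrimeProd_nonneg (q r : ℕ) (T : ℝ) : 0 ≤ largePrimeProd q r T := by
  refine Finset.prod_nonneg fun p hp => ?_
  have h1 : (1 : ℝ) < p := by
    exact_mod_cast (Nat.prime_of_mem_primeFactors (Finset.mem_filter.1 hp).1).one_lt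
  have : 0 ≤ 1 / ((p : ℝ) - 1) := one_div_nonneg.2 (by linarith)
  linarith

theorem largePrimeProd_comm (q r : ℕ) (T : ℝ) : largePrimeProd q r T = largePrimeProd r q T := by
  rw [largePrimeProd, largePrimeProd, mul_comm, Nat.gcd_comm]

theorem overlapD_comm (ψ : ℕ → ℝ) (q r : ℕ) : overlapD ψ q r = overlapD ψ r q := by
  rw [overlapD, overlapD, max_comm, Nat.gcd_comm]

/-- The sieve bound for the overlap, in terms of the smaller of the two radii. -/
theorem exists_overlap_le_of_radius_le :
    ∃ K : ℝ, 0 < K ∧ ∀ ψ : ℕ → ℝ, (∀ n : ℕ, 1 ≤ n → 0 ≤ ψ n ∧ ψ n ≤ 1 / 2) →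
      ∀ q r : ℕ, 1 ≤ q → 1 ≤ r → q ≠ r → ψ q / q ≤ ψ r / r →
      ∀ u T : ℝ, 1 ≤ u → 2 ≤ T →
        MeasureTheory.volume.real (approxSet ψ q ∩ approxSet ψ r) ≤
          MeasureTheory.volume.real (approxSet ψ q) * MeasureTheory.volume.real (approxSet ψ r) *
            (1 + K * (u ^ (-u / 2) +
              T ^ u * Real.log (overlapD ψ q r + 2) * Real.log T / overlapD ψ q r)) *
            largePrimeProd q r T ∧
        (overlapD ψ q r < 1 / 2 →
          MeasureTheory.volume.real (approxSet ψ q ∩ approxSet ψ r) = 0) := by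
  obtain ⟨K, hK, hpairs⟩ := exists_card_pairs_near_le
  refine ⟨K, hK, fun ψ hψ q r hq hr hqr hrad u T hu hT => ?_⟩
  obtain ⟨g, k, l, hg, hkl, rfl, rfl⟩ : ∃ g k l : ℕ, 0 < g ∧ k.Coprime l ∧ q = g * k ∧
      r = g * l := by
    obtain ⟨k, l, hkl, h1, h2⟩ := Nat.exists_coprime q r
    exact ⟨q.gcd r, k, l, Nat.gcd_pos_of_pos_left _ hq, hkl, by rw [mul_comm]; exact h1,
      by rw [mul_comm]; exact h2⟩
  have hk : 0 < k := Nat.pos_of_mul_pos_left hq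
  have hl : 0 < l := Nat.pos_of_mul_pos_left hr
  have hg' : (0 : ℝ) < g := by exact_mod_cast hg
  have hk' : (0 : ℝ) < k := by exact_mod_cast hk
  have hl' : (0 : ℝ) < l := by exact_mod_cast hl
  obtain ⟨hq0, hq1⟩ := hψ (g * k) hq
  obtain ⟨hr0, hr1⟩ := hψ (g * l) hr
  set δ := ψ (g * k) / ((g * k : ℕ) : ℝ) with hδ
  set ε := ψ (g * l) / ((g * l : ℕ) : ℝ) with hε
  have hδ0 : 0 ≤ δ := by positivity
  have hε0 : 0 ≤ ε := by positivity
  have hψq : ψ (g * k) = g * k * δ := by rw [hδ]; push_cast; field_simp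
  have hψr : ψ (g * l) = g * l * ε := by rw [hε]; push_cast; field_simp
  have hgcd : (g * k).gcd (g * l) = g := by rw [Nat.gcd_mul_left, hkl.gcd_eq_one, mul_one]
  have hD : overlapD ψ (g * k) (g * l) = g * k * l * ε := by
    rw [overlapD, hgcd, hψq, hψr, max_eq_right]
    · push_cast; field_simp
    · push_cast
      calc (g : ℝ) * l * (g * k * δ) ≤ g * l * (g * k * ε) := by gcongr
        _ = _ := by ring
  set D := overlapD ψ (g * k) (g * l) with hDdef
  have hD0 : 0 ≤ D := by rw [hD]; positivity
  have hpair_subset : ∀ y ∈ Set.Ioo (-δ) δ,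
      ∀ t ⊆ (Icc 1 (g * k)).filter (fun p => p.Coprime (g * k)),
      (∀ a ∈ t, ((a : ℝ) / ((g * k : ℕ) : ℝ)) + y ∈ approxSet ψ (g * l)) →
      #t ≤ #{x ∈ Icc 1 (g * k) ×ˢ Icc 1 (g * l) | x.1.Coprime (g * k) ∧ x.2.Coprime (g * l) ∧
        (x.1 * l - x.2 * k : ℤ) ∈ (intsIoo (-(g * k * l * y) - D) (-(g * k * l * y) + D)).erase 0} := by
    intro y hy t ht hty
    refine (Finset.card_le_card fun a ha => ?_).trans (Finset.card_image_le (f := Prod.fst))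
    obtain ⟨ha1, ha2⟩ := Finset.mem_filter.1 (ht ha)
    have h := hty a ha
    simp only [approxSet, Set.mem_iUnion, Set.mem_Ioo, exists_prop] at h
    obtain ⟨b, hb, hlt1, hlt2⟩ := h
    obtain ⟨hb1, hb2⟩ := Finset.mem_filter.1 hb
    rw [← hε] at hlt1 hlt2
    refine Finset.mem_image.2 ⟨(a, b), Finset.mem_filter.2 ⟨Finset.mem_product.2 ⟨ha1, hb1⟩,
      ha2, hb2, Finset.mem_erase.2 ⟨fun h0 => ?_, ?_⟩⟩, rfl⟩
    -- If m = 0, being prime to kl forces k = l = 1, that is, q = r.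
    · have hcop := coprime_of_pairs_diff hkl ha2 hb2
      rw [h0, Int.natAbs_zero, Nat.coprime_zero_left] at hcop
      have hk1 := Nat.eq_one_of_mul_eq_one_right hcop
      have hl1 := Nat.eq_one_of_mul_eq_one_left hcop
      exact hqr (by rw [hk1, hl1])
    · rw [mem_intsIoo]
      push_cast at hlt1 hlt2 ⊢
      have e : ((a : ℝ) * l - b * k) = g * k * l * (a / (g * k) - b / (g * l)) := by
        field_simp
      have hgkl : 0 < (g : ℝ) * k * l := by positivity
      rw [e, hD]
      constructor <;> nlinarith
  have hz : ∀ y ∈ Set.Ioo (-δ) δ, |(-((g : ℝ) * k * l * y))| ≤ D := by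
    intro y hy
    have hgkl : 0 < (g : ℝ) * k * l := by positivity
    rw [abs_neg, abs_mul, abs_of_pos hgkl, hD]
    have : |y| ≤ ε := (abs_lt.2 hy).le.trans hrad
    gcongr
  have hI : ∀ y : ℝ, ∀ m ∈ (intsIoo (-(g * k * l * y) - D) (-(g * k * l * y) + D)).erase 0,
      m ≠ 0 ∧ |(m : ℝ) - (-(g * k * l * y))| < D := by
    intro y m hm
    obtain ⟨hm0, hm1⟩ := Finset.mem_erase.1 hm
    rw [mem_intsIoo] at hm1
    exact ⟨hm0, abs_lt.2 ⟨by linarith [hm1.1], by linarith [hm1.2]⟩⟩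
  have hmeasure : ∀ B : ℝ, (∀ y ∈ Set.Ioo (-δ) δ,
      (#{x ∈ Icc 1 (g * k) ×ˢ Icc 1 (g * l) | x.1.Coprime (g * k) ∧ x.2.Coprime (g * l) ∧
        (x.1 * l - x.2 * k : ℤ) ∈ (intsIoo (-(g * k * l * y) - D) (-(g * k * l * y) + D)).erase 0} : ℝ)
        ≤ B) → 0 ≤ B →
      MeasureTheory.volume.real (approxSet ψ (g * k) ∩ approxSet ψ (g * l)) ≤ B * (2 * δ) := by
    intro B hB hB0
    have h := volume_biUnion_Ioo_inter_le (s := (Icc 1 (g * k)).filter (fun p => p.Coprime (g * k)))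
      (fun a => (a : ℝ) / ((g * k : ℕ) : ℝ)) (δ := δ) (measurableSet_approxSet ψ (g * l))
      (N := ⌊B⌋₊) fun y hy t ht hty =>
        (hpair_subset y hy t ht hty).trans (Nat.le_floor (hB y hy))
    rw [MeasureTheory.measureReal_def]
    refine (ENNReal.toReal_mono (ENNReal.mul_ne_top (ENNReal.natCast_ne_top _)
      ENNReal.ofReal_ne_top) h).trans ?_
    rw [ENNReal.toReal_mul, ENNReal.toReal_natCast, ENNReal.toReal_ofReal (by positivity)]
    gcongr
    exact Nat.floor_le hB0
  rcases lt_or_ge D (1 / 2) with hDs | hDl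
  -- Here |m| < 2D < 1 leaves only the excluded m = 0. This also covers D = 0, where the quotient by
  -- D takes its default value 0.
  · have h0 : MeasureTheory.volume.real (approxSet ψ (g * k) ∩ approxSet ψ (g * l)) = 0 := by
      refine le_antisymm ?_ MeasureTheory.measureReal_nonneg
      have := hmeasure 0 (fun y hy => ?_) le_rfl
      · simpa using this
      · rw [Finset.filter_false_of_mem]
        · simp
        · rintro x - ⟨-, -, hx⟩
          obtain ⟨hm0, hm1⟩ := hI y _ hx
          have h1 := abs_le.1 (hz y hy)
          have h2 := abs_lt.1 hm1
          have h3 : |(((x.1 * l - x.2 * k : ℤ)) : ℝ)| < 1 := by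
            rw [abs_lt]; constructor <;> linarith
          have h4 : |(x.1 * l - x.2 * k : ℤ)| < 1 := by exact_mod_cast h3
          exact hm0 (Int.abs_lt_one_iff.1 h4)
    refine ⟨?_, fun _ => h0⟩
    rw [h0]
    have hlT : 0 ≤ Real.log T := Real.log_nonneg (by linarith)
    have hlD : 0 ≤ Real.log (D + 2) := Real.log_nonneg (by linarith)
    have hL := largePrimeProd_nonneg (g * k) (g * l) T
    positivity
  · refine ⟨?_, fun h => absurd h (not_lt.2 hDl)⟩
    have hlT : 0 ≤ Real.log T := Real.log_nonneg (by linarith)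
    have hlD : 0 ≤ Real.log (D + 2) := Real.log_nonneg (by linarith)
    have hW : 0 ≤ ∏ p ∈ primesOff g (k * l), (1 - (p : ℝ)⁻¹) := Finset.prod_nonneg fun p hp =>
      (one_sub_prime_inv_pos (Nat.prime_of_mem_primeFactors (Finset.mem_filter.1 hp).1)).le
    have hV : 0 ≤ ∏ p ∈ (k * l).primeFactors with ((p : ℕ) : ℝ) ≤ T, (1 - (p : ℝ)⁻¹) :=
      Finset.prod_nonneg fun p hp =>
        (one_sub_prime_inv_pos (Nat.prime_of_mem_primeFactors (Finset.mem_filter.1 hp).1)).le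
    refine (hmeasure _ (fun y hy => hpairs g k l hg hk hl hkl u T D _ hu hT hDl (hz y hy) _
      (hI y)) (by positivity)).trans (le_of_eq ?_)
    rw [volume_real_approxSet hq hq0 hq1, volume_real_approxSet hr hr0 hr1, ← hδ, ← hε]
    set F := 1 + K * (u ^ (-u / 2) + T ^ u * Real.log (D + 2) * Real.log T / D)
    rw [prod_filter_le_eq_mul_largePrimeProd hg hkl T, hD]
    linear_combination (-4 * δ * ε * F * largePrimeProd (g * k) (g * l) T) *
      totient_mul_totient_eq hg hk hl hkl

theorem exists_overlap_le :
    ∃ K : ℝ, 0 < K ∧ ∀ ψ : ℕ → ℝ, (∀ n : ℕ, 1 ≤ n → 0 ≤ ψ n ∧ ψ n ≤ 1 / 2) →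
      ∀ q r : ℕ, 1 ≤ q → 1 ≤ r → q ≠ r → ∀ u T : ℝ, 1 ≤ u → 2 ≤ T →
        MeasureTheory.volume.real (approxSet ψ q ∩ approxSet ψ r) ≤
          MeasureTheory.volume.real (approxSet ψ q) * MeasureTheory.volume.real (approxSet ψ r) *
            (1 + K * (u ^ (-u / 2) +
              T ^ u * Real.log (overlapD ψ q r + 2) * Real.log T / overlapD ψ q r)) *
            largePrimeProd q r T ∧
        (overlapD ψ q r < 1 / 2 →
          MeasureTheory.volume.real (approxSet ψ q ∩ approxSet ψ r) = 0) := by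
  obtain ⟨K, hK, h⟩ := exists_overlap_le_of_radius_le
  refine ⟨K, hK, fun ψ hψ q r hq hr hqr u T hu hT => ?_⟩
  rcases le_total (ψ q / q) (ψ r / r) with hle | hle
  · exact h ψ hψ q r hq hr hqr hle u T hu hT
  · rw [overlapD_comm, largePrimeProd_comm, Set.inter_comm,
      mul_comm (MeasureTheory.volume.real (approxSet ψ q))]
    exact h ψ hψ r q hr hq hqr.symm hle u T hu hT

theorem overlapD_nonneg {ψ : ℕ → ℝ} {q r : ℕ} (hq : 0 ≤ ψ q) : 0 ≤ overlapD ψ q r :=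
  div_nonneg (le_max_of_le_left (by positivity)) (by positivity)

/-! ### Choice of parameters for the second bound -/

/-- The choice of the sieve parameter `u` belonging to the threshold `exp (x z / (8 C y) + 1)`,
where `x, y, z` are the iterated logarithms of `D + 100`. -/
theorem exists_sieve_parameter (C : ℝ) (hC : 1 ≤ C) :
    ∃ K : ℝ, 0 < K ∧ ∀ D x y z : ℝ, 1 / 2 ≤ D → x = Real.log (D + 100) → y = Real.log x →
      z = Real.log y → ∃ u : ℝ, 1 ≤ u ∧ 2 ≤ Real.exp (x * z / (8 * C * y) + 1) ∧
        u ^ (-u / 2) + Real.exp (x * z / (8 * C * y) + 1) ^ u * Real.log (D + 2) *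
          Real.log (Real.exp (x * z / (8 * C * y) + 1)) / D ≤ K * Real.log (D + 2) ^ (-C) := by
  -- The exponent collects 16C from T^u, 2 from the two logarithms and C from the target x^(-C). The
  -- power is absorbed by x^n ≤ n! 2^n e^(x/2), and 402 = 2 · 201 with (D + 100)/D ≤ 201 for D ≥
  -- 1/2.
  set n := ⌈17 * C + 2⌉₊ with hn
  refine ⟨1 + 402 * (n.factorial * 2 ^ n), by positivity, fun D x y z hD hx hy hz => ?_⟩
  have hC0 : 0 < C := by linarith
  have hX : 0 < D + 100 := by linarith
  have hl2 := Real.log_two_gt_d9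
  have hl4 : Real.log 4 = 2 * Real.log 2 := by
    rw [show (4 : ℝ) = 2 ^ 2 by norm_num, Real.log_pow]; norm_num
  have hx4 : 4 ≤ x := by
    rw [hx, Real.le_log_iff_exp_le hX, show (4 : ℝ) = ((4 : ℕ) : ℝ) * 1 by norm_num,
      Real.exp_nat_mul]
    have := Real.exp_one_lt_three
    have h3 : Real.exp 1 ^ 4 ≤ 3 ^ 4 := by gcongr
    linarith
  have hx0 : 0 < x := by linarith
  have hy1 : 4 / 3 ≤ y := by
    have := Real.log_le_log (by norm_num) hx4
    rw [hy]; linarith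
  have hy0 : 0 < y := by linarith
  have hyx : y ≤ x := by
    rw [hy]; linarith [Real.log_le_sub_one_of_pos hx0]
  have hz1 : 1 / 4 ≤ z := by
    have h1 := Real.one_sub_inv_le_log_of_pos hy0
    have h2 : y⁻¹ ≤ (4 / 3)⁻¹ := by gcongr
    rw [hz]; norm_num at h2; linarith
  have hz0 : 0 < z := by linarith
  have hzy : z ≤ y := by
    rw [hz]; linarith [Real.log_le_sub_one_of_pos hy0]
  set L := x * z / (8 * C * y) + 1 with hL
  have hL1 : 1 ≤ L := by
    have : 0 ≤ x * z / (8 * C * y) := by positivity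
    linarith
  have hLx : L ≤ 2 * x := by
    have : x * z / (8 * C * y) ≤ x := by
      rw [div_le_iff₀ (by positivity)]
      have h8 : z ≤ 8 * C * y := by nlinarith
      gcongr
    linarith
  -- This u balances both terms: u log u is at least about 2Cy, while u log T is x/2 + u, so T^u is
  -- roughly the square root of D + 100.
  set u := 4 * C * y / z with hu
  have hyz : 1 ≤ y / z := (one_le_div hz0).2 hzy
  have hu1 : y / z ≤ u := by
    rw [hu, mul_div_assoc]
    exact le_mul_of_one_le_left (by positivity) (by linarith)
  have hu0 : 0 < u := by linarith
  have hlD0 : 0 < Real.log (D + 2) := Real.log_pos (by linarith)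
  have hlDx : Real.log (D + 2) ≤ x := by
    rw [hx]; exact Real.log_le_log (by linarith) (by linarith)
  have hR : x ^ (-C) ≤ Real.log (D + 2) ^ (-C) :=
    Real.rpow_le_rpow_of_nonpos hlD0 hlDx (by linarith)
  have hxC : x ^ (-C) = Real.exp (-(C * y)) := by
    rw [Real.rpow_def_of_pos hx0, ← hy]; congr 1; ring
  refine ⟨u, by linarith, ?_, ?_⟩
  · have := Real.add_one_le_exp L
    linarith
  -- Since log y = z, log u ≥ log(y/z) = z - log z ≥ z/2, and (u/2)(z/2) = Cy.
  have hmain : u ^ (-u / 2) ≤ x ^ (-C) := by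
    rw [hxC, Real.rpow_def_of_pos hu0]
    apply Real.exp_le_exp.2
    have h1 : Real.log (y / z) ≤ Real.log u := Real.log_le_log (by positivity) hu1
    rw [Real.log_div hy0.ne' hz0.ne', ← hz] at h1
    have h2 : Real.log z ≤ z / 2 := by
      have h3 := Real.log_le_sub_one_of_pos (show 0 < z / 2 by positivity)
      rw [Real.log_div hz0.ne' (by norm_num)] at h3
      linarith [Real.log_two_lt_d9]
    have h3 : z / 2 ≤ Real.log u := by linarith
    have h4 : u / 2 * (z / 2) = C * y := by rw [hu]; field_simp; ring
    have h5 : u / 2 * (z / 2) ≤ u / 2 * Real.log u := by gcongr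
    linarith
  -- Here Lu = x/2 + u exactly, the extra u coming from the +1 in the threshold; z ≥ 1/4 gives u ≤
  -- 16Cy.
  have hTu : Real.exp L ^ u ≤ Real.exp (x / 2) * x ^ (16 * C) := by
    rw [← Real.exp_mul, Real.rpow_def_of_pos hx0, ← hy, ← Real.exp_add]
    apply Real.exp_le_exp.2
    have h1 : L * u = x / 2 + 4 * C * y / z := by
      rw [hL, hu]; field_simp; ring
    have h2 : 4 * C * y / z ≤ y * (16 * C) := by
      rw [div_le_iff₀ hz0]
      have := mul_pos hC0 hy0
      nlinarith
    linarith
  have hpoly : x ^ (17 * C + 2) ≤ n.factorial * 2 ^ n * Real.exp (x / 2) := by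
    have h1 : x ^ (17 * C + 2) ≤ x ^ (n : ℝ) :=
      Real.rpow_le_rpow_of_exponent_le (by linarith) (Nat.le_ceil _)
    rw [Real.rpow_natCast] at h1
    have h2 := Real.pow_div_factorial_le_exp (x / 2) (by positivity) n
    rw [div_le_iff₀ (by positivity), div_pow, div_le_iff₀ (by positivity)] at h2
    linarith
  have hDX : Real.exp x / D ≤ 201 := by
    rw [hx, Real.exp_log hX, div_le_iff₀ (by linarith)]
    linarith
  have herr : Real.exp L ^ u * Real.log (D + 2) * Real.log (Real.exp L) / D ≤
      402 * (n.factorial * 2 ^ n) * x ^ (-C) := by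
    rw [Real.log_exp]
    have hD0 : 0 < D := by linarith
    have e1 : x ^ (16 * C) * (x * (2 * x)) = 2 * (x ^ (17 * C + 2) * x ^ (-C)) := by
      rw [← Real.rpow_add hx0, show 17 * C + 2 + -C = 16 * C + 2 by ring, Real.rpow_add hx0,
        Real.rpow_two]
      ring
    calc _ ≤ Real.exp (x / 2) * x ^ (16 * C) * x * (2 * x) / D := by gcongr
      _ = Real.exp (x / 2) * (x ^ (16 * C) * (x * (2 * x))) / D := by ring
      _ = 2 * Real.exp (x / 2) * (x ^ (17 * C + 2) * x ^ (-C)) / D := by rw [e1]; ring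
      _ ≤ 2 * Real.exp (x / 2) * ((n.factorial * 2 ^ n * Real.exp (x / 2)) * x ^ (-C)) / D := by
          gcongr
      _ = 2 * (n.factorial * 2 ^ n) * x ^ (-C) * (Real.exp (x / 2) * Real.exp (x / 2) / D) := by
          ring
      _ = 2 * (n.factorial * 2 ^ n) * x ^ (-C) * (Real.exp x / D) := by
          rw [← Real.exp_add, add_halves]
      _ ≤ 2 * (n.factorial * 2 ^ n) * x ^ (-C) * 201 := by gcongr
      _ = _ := by ring
  calc _ ≤ x ^ (-C) + 402 * (n.factorial * 2 ^ n) * x ^ (-C) := add_le_add hmain herr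
    _ = (1 + 402 * (n.factorial * 2 ^ n)) * x ^ (-C) := by ring
    _ ≤ _ := by gcongr

end DuffinSchaeffer

theorem lemma3p3 :
    (∃ K : ℝ, 0 < K ∧
      ∀ ψ : ℕ → ℝ, (∀ n : ℕ, 1 ≤ n → 0 ≤ ψ n ∧ ψ n ≤ 1 / 2) →
      ∀ q r : ℕ, 1 ≤ q → 1 ≤ r → q ≠ r →
      ∀ u T : ℝ, 1 ≤ u → 2 ≤ T →
        MeasureTheory.volume.real
            (DuffinSchaeffer.approxSet ψ q ∩ DuffinSchaeffer.approxSet ψ r) ≤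
          MeasureTheory.volume.real (DuffinSchaeffer.approxSet ψ q) *
            MeasureTheory.volume.real (DuffinSchaeffer.approxSet ψ r) *
            (1 + K * (u ^ (-u / 2) +
              T ^ u * Real.log (DuffinSchaeffer.overlapD ψ q r + 2) * Real.log T /
                DuffinSchaeffer.overlapD ψ q r)) *
            DuffinSchaeffer.largePrimeProd q r T) ∧
    (∀ C : ℝ, 1 ≤ C → ∃ K : ℝ, 0 < K ∧
      ∀ ψ : ℕ → ℝ, (∀ n : ℕ, 1 ≤ n → 0 ≤ ψ n ∧ ψ n ≤ 1 / 2) →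
      ∀ q r : ℕ, 1 ≤ q → 1 ≤ r → q ≠ r →
        MeasureTheory.volume.real
            (DuffinSchaeffer.approxSet ψ q ∩ DuffinSchaeffer.approxSet ψ r) ≤
          MeasureTheory.volume.real (DuffinSchaeffer.approxSet ψ q) *
            MeasureTheory.volume.real (DuffinSchaeffer.approxSet ψ r) *
            (1 + K * Real.log (DuffinSchaeffer.overlapD ψ q r + 2) ^ (-C)) *
            DuffinSchaeffer.largePrimeProd q r (DuffinSchaeffer.thresholdA ψ C q r)) := by
  obtain ⟨K, hK, h⟩ := DuffinSchaeffer.exists_overlap_le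
  refine ⟨⟨K, hK, fun ψ hψ q r hq hr hqr u T hu hT => (h ψ hψ q r hq hr hqr u T hu hT).1⟩,
    fun C hC => ?_⟩
  obtain ⟨K', hK', h'⟩ := DuffinSchaeffer.exists_sieve_parameter C hC
  refine ⟨K * K', by positivity, fun ψ hψ q r hq hr hqr => ?_⟩
  have hL := DuffinSchaeffer.largePrimeProd_nonneg q r (DuffinSchaeffer.thresholdA ψ C q r)
  rcases lt_or_ge (DuffinSchaeffer.overlapD ψ q r) (1 / 2) with hD | hD
  -- For D < 1/2 the overlap is null; the values u = 1, T = 2 are arbitrary.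
  · rw [(h ψ hψ q r hq hr hqr 1 2 le_rfl le_rfl).2 hD]
    have hD0 : 0 ≤ DuffinSchaeffer.overlapD ψ q r := DuffinSchaeffer.overlapD_nonneg (hψ q hq).1
    have hlog : 0 ≤ Real.log (DuffinSchaeffer.overlapD ψ q r + 2) :=
      Real.log_nonneg (by linarith)
    positivity
  · obtain ⟨u, hu, hT, hbound⟩ := h' _ _ _ _ hD rfl rfl rfl
    refine (h ψ hψ q r hq hr hqr u _ hu hT).1.trans ?_
    rw [← DuffinSchaeffer.thresholdA] at hbound ⊢
    rw [mul_assoc K K']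
    gcongr
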